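/- Let $\mathcal H$ be a complex separable Hilbert space with an orthogonal decomposition $\mathcal H=\mathcal H_+\oplus\mathcal H_-$ into two infinite-dimensional closed subspaces, let $\mathrm{pr}_\pm$ be the orthogonal projections onto $\mathcal H_\pm$, and put $d=i(\mathrm{pr}_+-\mathrm{pr}_-)$. For Hilbert spaces $\mathcal H_1,\mathcal H_2$ and $1\le p<\infty$ let $L_p(\mathcal H_1,\mathcal H_2)$ be the Schatten class of bounded operators $A:\mathcal H_1\to\mathcal H_2$ with $\mathrm{Tr}\,(A^*A)^{p/2}<\infty$, let $L_\infty(\mathcal H_1,\mathcal H_2)$ be the set of compact operators, and write $L_p(\mathcal H_1)=L_p(\mathcal H_1,\mathcal H_1)$. For $1\le p,q\le\infty$ put $$L_{\mathrm{res},p}=\{A\in\mathcal B(\mathcal H)\mid [d,A]\in L_p(\mathcal H)\},$$ $$L_{1,q}=\{\rho\in\mathcal B(\mathcal H)\mid [d,\rho]\in L_q(\mathcal H),\ \mathrm{pr}_\pm\rho|_{\mathcal H_\pm}\in L_1(\mathcal H_\pm)\}.$$ For $\rho\in L_{1,q}$ with diagonal blocks $\rho_{++}=\mathrm{pr}_+\rho|_{\mathcal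 H_+}$ and $\rho_{--}=\mathrm{pr}_-\rho|_{\mathcal H_-}$, the restricted trace is $\mathrm{Tr_{res}}(\rho)=\mathrm{Tr}(\rho_{++})+\mathrm{Tr}(\rho_{--})$. Write $\langle\alpha,A\rangle=\mathrm{Tr_{res}}(\alpha A)$. **Proposition.** Let $p,q\in[1,\infty]$ with $\frac1p+\frac1q=1$ (with $\frac1\infty=0$). 1. For all $A\in L_{\mathrm{res},p}$ and $\alpha\in L_{1,q}$, the products $A\alpha$ and $\alpha A$ lie in $L_{1,q}$, and $\mathrm{Tr_{res}}(A\alpha)=\mathrm{Tr_{res}}(\alpha A)$. 2. Let $g\in L_{\mathrm{res},p}$ be invertible as a bounded operator on $\mathcal H$. Then $g^{-1}\in L_{\mathrm{res},p}$. For all $A\in L_{\mathrm{res},p}$ and $\alpha\in L_{1,q}$ one has $gAg^{-1}\in L_{\mathrm{res},p}$; the operators $g^{-1}\alpha g$, $\alpha gAg^{-1}$ and $g^{-1}\alpha gA$ lie in $L_{1,q}$; and $$\langle\alpha,gAg^{-1}\rangle=\mathrm{Tr_{res}}(\alpha gAg^{-1})=\mathrm{Tr_{res}}(g^{-1}\alpha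 gA)=\langle g^{-1}\alpha g,A\rangle.$$ In particular, for all $\alpha\in L_{1,q}$ one has $g\alpha g^{-1}\in L_{1,q}$ and $\mathrm{Tr_{res}}(g\alpha g^{-1})=\mathrm{Tr_{res}}(\alpha)$. -/

import Mathlib

open scoped ENNReal

namespace RestrictedTrace

noncomputable section

/-- The index set of a fixed Hilbert basis of `E`. -/
def basisIndex (E : Type*) [NormedAddCommGroup E] [InnerProductSpace ℂ E] [CompleteSpace E] :
    Set E :=
  (exists_hilbertBasis ℂ E).choose

/-- A fixed Hilbert basis (complete orthonormal system) of `E`. -/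
def stdBasis (E : Type*) [NormedAddCommGroup E] [InnerProductSpace ℂ E] [CompleteSpace E] :
    HilbertBasis (basisIndex E) ℂ E :=
  (exists_hilbertBasis ℂ E).choose_spec.choose

/-- The trace in `[0, ∞]` of a positive bounded operator `T`, that is `∑ ⟨e i, T (e i)⟩` along an
orthonormal basis (the value does not depend on the basis, see `posTrace_eq`). -/
def posTrace {E : Type*} [NormedAddCommGroup E] [InnerProductSpace ℂ E] [CompleteSpace E]
    (T : E →L[ℂ] E) : ℝ≥0∞ :=
  ∑' i, ENNReal.ofReal (inner ℂ (stdBasis E i) (T (stdBasis E i))).re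

theorem ofReal_norm_sq_eq_tsum {E : Type*} [NormedAddCommGroup E] [InnerProductSpace ℂ E]
    {κ : Type*} (c : HilbertBasis κ ℂ E) (x : E) :
    ENNReal.ofReal (‖x‖ ^ 2) = ∑' j, ENNReal.ofReal (‖inner ℂ (c j) x‖ ^ 2) := by
  have h := Complex.hasSum_re (c.hasSum_inner_mul_inner x x)
  have h1 : ∀ j, (inner ℂ x (c j) * inner ℂ (c j) x).re = ‖inner ℂ (c j) x‖ ^ 2 := fun j => by
    rw [← inner_conj_symm x (c j), Complex.conj_mul']
    norm_cast
  have h2 : (inner ℂ x x).re = ‖x‖ ^ 2 := (norm_sq_eq_re_inner (𝕜 := ℂ) x).symm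
  simp only [h1, h2] at h
  rw [← h.tsum_eq, ENNReal.ofReal_tsum_of_nonneg (fun j => by positivity) h.summable]

/-- The trace of a positive operator can be computed in every Hilbert basis. -/
theorem posTrace_eq {E : Type*} [NormedAddCommGroup E] [InnerProductSpace ℂ E] [CompleteSpace E]
    {ι : Type*} (b : HilbertBasis ι ℂ E) (T : E →L[ℂ] E) (hT : 0 ≤ T) :
    posTrace T = ∑' i, ENNReal.ofReal (inner ℂ (b i) (T (b i))).re := by
  obtain ⟨S, hS, hST⟩ : ∃ S : E →L[ℂ] E, IsSelfAdjoint S ∧ S * S = T :=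
    ⟨CFC.sqrt T, (CFC.sqrt_nonneg T).isSelfAdjoint, CFC.sqrt_mul_sqrt_self T hT⟩
  have hsymm : ∀ x y : E, inner ℂ (S x) y = inner ℂ x (S y) := fun x y => by
    rw [← ContinuousLinearMap.adjoint_inner_right, hS.adjoint_eq]
  have hsq : ∀ x : E, (inner ℂ x (T x)).re = ‖S x‖ ^ 2 := fun x => by
    rw [← hST, mul_apply_eq_comp, ← hsymm]
    exact (norm_sq_eq_re_inner (𝕜 := ℂ) (S x)).symm
  unfold posTrace
  simp only [hsq]
  calc ∑' i, ENNReal.ofReal (‖S (stdBasis E i)‖ ^ 2)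
      = ∑' i, ∑' j, ENNReal.ofReal (‖inner ℂ (b j) (S (stdBasis E i))‖ ^ 2) :=
        tsum_congr fun i => ofReal_norm_sq_eq_tsum b _
    _ = ∑' j, ∑' i, ENNReal.ofReal (‖inner ℂ (b j) (S (stdBasis E i))‖ ^ 2) := ENNReal.tsum_comm
    _ = ∑' j, ENNReal.ofReal (‖S (b j)‖ ^ 2) := tsum_congr fun j => by
        rw [ofReal_norm_sq_eq_tsum (stdBasis E) (S (b j))]
        refine tsum_congr fun i => ?_
        rw [← hsymm, norm_inner_symm]

/-- The trace `∑ ⟨e i, T (e i)⟩` of a trace class operator `T`. It is only meant for `T` in the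
Schatten class of exponent `1`, where the series converges absolutely and its sum does not depend
on the orthonormal basis. -/
def trace {E : Type*} [NormedAddCommGroup E] [InnerProductSpace ℂ E] [CompleteSpace E]
    (T : E →L[ℂ] E) : ℂ :=
  ∑' i, inner ℂ (stdBasis E i) (T (stdBasis E i))

/-- Membership in the Schatten class `L_p(E, F)`: for `p < ∞` this is `Tr (A* A)^(p/2) < ∞`, with
the real power taken in the continuous functional calculus of bounded operators, and `L_∞(E, F)`
consists of the compact operators. -/
def IsSchatten {E F : Type*} [NormedAddCommGroup E] [InnerProductSpace ℂ E] [CompleteSpace E]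
    [NormedAddCommGroup F] [InnerProductSpace ℂ F] [CompleteSpace F]
    (p : ℝ≥0∞) (A : E →L[ℂ] F) : Prop :=
  (p = ∞ → IsCompactOperator A) ∧
    (p ≠ ∞ → posTrace ((ContinuousLinearMap.adjoint A ∘L A) ^ (p.toReal / 2)) < ∞)

section Polarized

variable {H : Type*} [NormedAddCommGroup H] [InnerProductSpace ℂ H] [CompleteSpace H]
  (Hp : Submodule ℂ H) [CompleteSpace Hp]

/-- The operator `d = i (pr₊ - pr₋)` on `H = H₊ ⊕ H₋`, where `H₊ = Hp` and `H₋ = Hpᗮ`. -/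
def dOp : H →L[ℂ] H :=
  Complex.I • (Hp.starProjection - Hpᗮ.starProjection)

/-- The restricted algebra `L_{res,p}(H)`: bounded `A` with `[d, A]` in `L_p(H)`. -/
def Lres (p : ℝ≥0∞) : Set (H →L[ℂ] H) :=
  {A | IsSchatten p (dOp Hp * A - A * dOp Hp)}

/-- The compression `pr_K ∘ ρ|_K : K → K` of `ρ` to a closed subspace `K`. -/
def diagBlock (K : Submodule ℂ H) [CompleteSpace K] (ρ : H →L[ℂ] H) : K →L[ℂ] K :=
  K.orthogonalProjectionOnto ∘L ρ ∘L K.subtypeL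

/-- The space `L_{1,q}(H)`: bounded `ρ` with `[d, ρ]` in `L_q(H)` and both diagonal blocks
`ρ₊₊`, `ρ₋₋` trace class. -/
def L1 (q : ℝ≥0∞) : Set (H →L[ℂ] H) :=
  {ρ | IsSchatten q (dOp Hp * ρ - ρ * dOp Hp) ∧
    IsSchatten 1 (diagBlock Hp ρ) ∧ IsSchatten 1 (diagBlock Hpᗮ ρ)}

/-- The restricted trace `Tr_res ρ = Tr ρ₊₊ + Tr ρ₋₋`. -/
def trRes (ρ : H →L[ℂ] H) : ℂ :=
  trace (diagBlock Hp ρ) + trace (diagBlock Hpᗮ ρ)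

/-- The pairing `⟨α, A⟩ = Tr_res (α A)`. -/
def pairing (α A : H →L[ℂ] H) : ℂ :=
  trRes Hp (α * A)

end Polarized

end

end RestrictedTrace

namespace RestrictedTrace

open scoped NNReal ComplexOrder

universe u

/-! The commutator with $d$ kills the diagonal blocks of an operator and multiplies the off-diagonal
ones by $\pm 2i$. Hence `Lres` asks for off-diagonal blocks in $L_p$, and `L1` for off-diagonal
blocks in $L_q$ and diagonal blocks in $L_1$ (`mem_Lres_iff`, `mem_L1_iff`). After block
multiplication, membership of products reduces to the ideal property, $L_1\subset L_q$ and Hölder's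
$L_pL_q\subset L_1$; the trace identity reduces to $\mathrm{Tr}(ST)=\mathrm{Tr}(TS)$ for four pairs
of blocks (`IsSchatten.traceCommutes`). Inverses are handled by $[d,g^{-1}]=-g^{-1}[d,g]g^{-1}$, and
the statements on conjugation follow formally.

The Schatten theory rests on Bessel families, which, unlike orthonormal ones, survive bounded
operators. For finite $r\ge1$, $A\in L_r$ means that $A$ has an expansion $\sum s_n\langle
v_n,\cdot\rangle w_n$ with $s\in\ell^r$ (`HasSchmidtRep`), or equivalently that $A$ is compact with
$\ell^r$ matrix coefficients (`HasSummableCoeffs`). The first form gives the ideal property, the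
second closure under sums.

For Hölder with finite exponents, one of them is some $r\ge2$, and the factor $S\in L_r$ satisfies
$\sum\|Se_i\|^r<\infty$ on Bessel families. Inserting the expansion of the other factor $T$ turns
$ST$ and $TS$ into absolutely convergent sums of rank-one operators, both of trace $\sum s_n\langle
v_n,Sw_n\rangle$. For the exponents $1,\infty$ boundedness of $S$ suffices. -/

theorem ennreal_inner_le_Lp_mul_Lq_tsum {ι : Type*} (f g : ι → ℝ≥0∞) {p q : ℝ}
    (hpq : p.HolderConjugate q) :
    ∑' i, f i * g i ≤ (∑' i, f i ^ p) ^ (1 / p) * (∑' i, g i ^ q) ^ (1 / q) := by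
  rw [ENNReal.tsum_eq_iSup_sum]
  refine iSup_le fun s => (ENNReal.inner_le_Lp_mul_Lq s f g hpq).trans ?_
  have := hpq.pos
  have := hpq.symm.pos
  gcongr <;> exact ENNReal.sum_le_tsum s

/-- Jensen's inequality for weights of arbitrary total mass; it drives the Schur-test estimates
below. -/
theorem ennreal_tsum_weight_rpow_le {ι : Type*} (w f : ι → ℝ≥0∞) {p : ℝ} (hp : 1 ≤ p) :
    (∑' i, w i * f i) ^ p ≤ (∑' i, w i) ^ (p - 1) * ∑' i, w i * f i ^ p := by
  have hp0 : 0 < p := by linarith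
  have h : ∑' i, w i * f i ≤ (∑' i, w i) ^ (1 - p⁻¹) * (∑' i, w i * f i ^ p) ^ p⁻¹ := by
    rw [ENNReal.tsum_eq_iSup_sum]
    refine iSup_le fun s => (ENNReal.inner_le_weight_mul_Lp_of_nonneg s hp w f).trans ?_
    have : 0 ≤ 1 - p⁻¹ := by
      have := inv_le_one_of_one_le₀ hp
      linarith
    gcongr <;> exact ENNReal.sum_le_tsum s
  calc (∑' i, w i * f i) ^ p
      ≤ ((∑' i, w i) ^ (1 - p⁻¹) * (∑' i, w i * f i ^ p) ^ p⁻¹) ^ p := by gcongr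
    _ = _ := by
      rw [ENNReal.mul_rpow_of_nonneg _ _ hp0.le, ← ENNReal.rpow_mul, ← ENNReal.rpow_mul,
        inv_mul_cancel₀ hp0.ne', ENNReal.rpow_one]
      congr 2
      field_simp

/-! ### Bessel families -/

section Bessel

variable {ι E F : Type*} [NormedAddCommGroup E] [InnerProductSpace ℂ E]
  [NormedAddCommGroup F] [InnerProductSpace ℂ F]

/-- A Bessel family: its coefficient map is a bounded operator into `ℓ²`. -/
def IsBessel (e : ι → E) : Prop :=
  ∃ C : ℝ≥0, ∀ x, ∑' i, ‖inner ℂ (e i) x‖ₑ ^ 2 ≤ C * ‖x‖ₑ ^ 2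

theorem enorm_inner_symm (x y : E) : ‖inner ℂ x y‖ₑ = ‖inner ℂ y x‖ₑ := by
  rw [← ofReal_norm, ← ofReal_norm, norm_inner_symm]

theorem enorm_inner_self (x : E) : ‖inner ℂ x x‖ₑ = ‖x‖ₑ ^ 2 := by
  rw [← ofReal_norm, ← ofReal_norm, inner_self_eq_norm_sq_to_K,
    ← ENNReal.ofReal_pow (norm_nonneg _)]
  simp

theorem tsum_enorm_inner_sq (b : HilbertBasis ι ℂ E) (x : E) :
    ∑' i, ‖inner ℂ (b i) x‖ₑ ^ 2 = ‖x‖ₑ ^ 2 := by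
  have h := ofReal_norm_sq_eq_tsum b x
  simp only [ENNReal.ofReal_pow (norm_nonneg _), ofReal_norm] at h
  exact h.symm

theorem isBessel_hilbertBasis (b : HilbertBasis ι ℂ E) : IsBessel b :=
  ⟨1, fun x => by rw [tsum_enorm_inner_sq]; simp⟩

/-- Testing the Bessel bound on $x=e_i$ and keeping one term gives $\|e_i\|^4\le C\|e_i\|^2$. -/
theorem IsBessel.exists_enorm_le {e : ι → E} (he : IsBessel e) :
    ∃ C : ℝ≥0, ∀ i, ‖e i‖ₑ ≤ C := by
  obtain ⟨C, hC⟩ := he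
  refine ⟨NNReal.sqrt C, fun i => ?_⟩
  have h1 : (‖e i‖ₑ ^ 2) ^ 2 ≤ C * ‖e i‖ₑ ^ 2 := by
    rw [← enorm_inner_self]
    calc _ ≤ ∑' j, ‖inner ℂ (e j) (e i)‖ₑ ^ 2 :=
          ENNReal.le_tsum (f := fun j => ‖inner ℂ (e j) (e i)‖ₑ ^ 2) i
      _ ≤ _ := hC _
      _ = _ := by rw [enorm_inner_self]
  by_cases h0 : ‖e i‖ₑ = 0
  · simp [h0]
  have h2 : ‖e i‖ₑ ^ 2 ≤ C := by
    rw [sq (‖e i‖ₑ ^ 2)] at h1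
    exact (ENNReal.mul_le_mul_iff_left (by simpa using h0)
      (ENNReal.pow_ne_top enorm_ne_top)).1 h1
  have h3 : ‖e i‖₊ ^ 2 ≤ C := by
    rw [enorm_eq_nnnorm] at h2
    exact_mod_cast h2
  rw [enorm_eq_nnnorm]
  exact_mod_cast NNReal.le_sqrt_iff_sq_le.2 h3

theorem IsBessel.exists_tsum_mul_le {v : ι → E} {w : ι → F} (hv : IsBessel v) (hw : IsBessel w) :
    ∃ K : ℝ≥0, ∀ x y, ∑' i, ‖inner ℂ (v i) x‖ₑ * ‖inner ℂ (w i) y‖ₑ ≤ K * (‖x‖ₑ * ‖y‖ₑ) := by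
  obtain ⟨C, hC⟩ := hv
  obtain ⟨D, hD⟩ := hw
  refine ⟨C ^ (1 / 2 : ℝ) * D ^ (1 / 2 : ℝ), fun x y => ?_⟩
  refine (ennreal_inner_le_Lp_mul_Lq_tsum _ _ Real.HolderConjugate.two_two).trans ?_
  simp only [ENNReal.rpow_two]
  calc _ ≤ (C * ‖x‖ₑ ^ 2) ^ (1 / 2 : ℝ) * (D * ‖y‖ₑ ^ 2) ^ (1 / 2 : ℝ) := by
        gcongr
        · exact hC x
        · exact hD y
    _ = _ := by
        have h : ∀ z : ℝ≥0∞, (z ^ 2) ^ (1 / 2 : ℝ) = z := fun z => by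
          rw [← ENNReal.rpow_two, ← ENNReal.rpow_mul]; norm_num
        rw [ENNReal.mul_rpow_of_nonneg _ _ (by norm_num),
          ENNReal.mul_rpow_of_nonneg _ _ (by norm_num), h, h,
          ENNReal.coe_mul, ENNReal.coe_rpow_of_nonneg _ (by norm_num),
          ENNReal.coe_rpow_of_nonneg _ (by norm_num)]
        ring

theorem IsBessel.map [CompleteSpace E] [CompleteSpace F] {e : ι → E} (he : IsBessel e)
    (T : E →L[ℂ] F) : IsBessel fun i => T (e i) := by
  obtain ⟨C, hC⟩ := he
  refine ⟨C * ‖ContinuousLinearMap.adjoint T‖₊ ^ 2, fun y => ?_⟩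
  simp only [← ContinuousLinearMap.adjoint_inner_right]
  refine (hC _).trans ?_
  rw [ENNReal.coe_mul, mul_assoc, ENNReal.coe_pow, ← mul_pow]
  gcongr
  exact (ContinuousLinearMap.adjoint T).le_opENorm y

/-- Zero vectors are allowed because left singular vectors are set to $0$ where the singular value
vanishes. -/
theorem isBessel_of_orthonormal_support {e : ι → E}
    (he : Orthonormal ℂ fun i : {i // e i ≠ 0} => e i) : IsBessel e := by
  refine ⟨1, fun x => ?_⟩
  have h : Function.support (fun i => ‖inner ℂ (e i) x‖ₑ ^ 2) ⊆ {i | e i ≠ 0} := by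
    intro i hi h0
    simp [show e i = 0 from h0] at hi
  rw [← tsum_subtype_eq_of_support_subset h, ENNReal.tsum_eq_iSup_sum]
  refine iSup_le fun s => ?_
  have h1 := he.sum_inner_products_le x (s := s)
  have h2 := ENNReal.ofReal_le_ofReal h1
  rw [ENNReal.ofReal_sum_of_nonneg (fun _ _ => by positivity)] at h2
  simpa only [ENNReal.ofReal_pow (norm_nonneg _), ofReal_norm, ENNReal.coe_one,
    one_mul] using h2

end Bessel

/-! ### Rank-one operators and limits of compact operators -/

section Compact

variable {E F : Type*} [NormedAddCommGroup E] [InnerProductSpace ℂ E]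
  [NormedAddCommGroup F] [InnerProductSpace ℂ F]

/-- The operator `x ↦ ⟨a, x⟩ b`. -/
noncomputable def rankOneOp (a : E) (b : F) : E →L[ℂ] F :=
  (innerSL ℂ a).smulRight b

theorem rankOneOp_apply (a : E) (b : F) (x : E) : rankOneOp a b x = inner ℂ a x • b := by
  simp [rankOneOp]

theorem norm_rankOneOp (a : E) (b : F) : ‖rankOneOp a b‖ = ‖a‖ * ‖b‖ := by
  simp [rankOneOp, ContinuousLinearMap.norm_smulRight_apply]

theorem isCompactOperator_rankOneOp (a : E) (b : F) : IsCompactOperator (rankOneOp a b) := by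
  have h : IsCompactOperator (innerSL ℂ a : E →L[ℂ] ℂ) :=
    isCompactOperator_of_locallyCompactSpace_dom _
  exact h.clm_comp (ContinuousLinearMap.toSpanSingleton ℂ b)

theorem isCompactOperator_sum {ι : Type*} (s : Finset ι) (f : ι → E →L[ℂ] F)
    (h : ∀ i ∈ s, IsCompactOperator (f i)) : IsCompactOperator (∑ i ∈ s, f i : E →L[ℂ] F) := by
  classical
  induction s using Finset.induction_on with
  | empty => simpa using isCompactOperator_zero
  | insert i s hi ih =>
    rw [Finset.sum_insert hi]
    exact (h i (Finset.mem_insert_self i s)).add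
      (ih fun j hj => h j (Finset.mem_insert_of_mem hj))

theorem isCompactOperator_of_approx [CompleteSpace F] {A : E →L[ℂ] F}
    (h : ∀ ε > (0 : ℝ), ∃ B : E →L[ℂ] F, IsCompactOperator B ∧
      ∀ x y, ‖inner ℂ y ((A - B) x)‖ ≤ ε * ‖x‖ * ‖y‖) : IsCompactOperator A := by
  have hcl : IsClosed {f : E →L[ℂ] F | IsCompactOperator f} := isClosed_setOfPred_isCompactOperator
  refine hcl.closure_subset (Metric.mem_closure_iff.2 fun ε hε => ?_)
  obtain ⟨B, hB, hAB⟩ := h (ε / 2) (by positivity)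
  refine ⟨B, hB, ?_⟩
  rw [dist_eq_norm]
  refine lt_of_le_of_lt (ContinuousLinearMap.opNorm_le_bound _ (by positivity) fun x => ?_)
    (half_lt_self hε)
  by_cases h0 : ‖(A - B) x‖ = 0
  · rw [h0]; positivity
  -- Taking $y=(A-B)x$ turns the bound on the sesquilinear form into an operator norm bound.
  have h1 := hAB x ((A - B) x)
  rw [inner_self_eq_norm_sq_to_K] at h1
  have h2 : ‖(A - B) x‖ * ‖(A - B) x‖ ≤ ε / 2 * ‖x‖ * ‖(A - B) x‖ := by
    simpa [sq] using h1
  exact le_of_mul_le_mul_right h2 (lt_of_le_of_ne (norm_nonneg _) (Ne.symm h0))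

end Compact

/-! ### Eigenbases and functional calculus on eigenvectors -/

section Spectral

variable {E : Type u} [NormedAddCommGroup E] [InnerProductSpace ℂ E] [CompleteSpace E]

/-- A compact self-adjoint operator has a Hilbert basis of eigenvectors. -/
theorem exists_hilbertBasis_eigenvectors {T : E →L[ℂ] E} (hT : IsCompactOperator T)
    (hsa : IsSelfAdjoint T) :
    ∃ (ι : Type u) (b : HilbertBasis ι ℂ E) (μ : ι → ℂ), ∀ i, T (b i) = μ i • b i := by
  have hsymm : (T : E →ₗ[ℂ] E).IsSymmetric := hsa.isSymmetric
  have hc : ∀ μ : ℂ, CompleteSpace (Module.End.eigenspace (T : E →ₗ[ℂ] E) μ) := fun μ => by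
    have : IsClosed (Module.End.eigenspace (T : E →ₗ[ℂ] E) μ : Set E) := by
      have h : (Module.End.eigenspace (T : E →ₗ[ℂ] E) μ : Set E) = {x | T x = μ • x} := by
        ext x
        simp
      rw [h]
      exact isClosed_eq T.continuous (continuous_const_smul μ)
    exact this.completeSpace_coe
  let w : (Σ μ : ℂ, basisIndex (Module.End.eigenspace (T : E →ₗ[ℂ] E) μ)) → E :=
    fun a => (stdBasis (Module.End.eigenspace (T : E →ₗ[ℂ] E) a.1) a.2 : E)
  have hw : Orthonormal ℂ w :=
    hsymm.orthogonalFamily_eigenspaces.orthonormal_sigma_orthonormal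
      (v_family := fun μ => stdBasis (Module.End.eigenspace (T : E →ₗ[ℂ] E) μ))
      fun μ => (stdBasis _).orthonormal
  have hbot : (Submodule.span ℂ (Set.range w))ᗮ = ⊥ := by
    rw [eq_bot_iff, ← ContinuousLinearMap.orthogonalComplement_iSup_eigenspaces_eq_bot hT hsymm]
    intro x hx
    rw [Submodule.mem_orthogonal] at hx ⊢
    -- Orthogonality to the chosen basis vectors extends to each whole eigenspace by expanding $y$
    -- in its basis.
    have key : ∀ μ, ∀ y : Module.End.eigenspace (T : E →ₗ[ℂ] E) μ, inner ℂ (y : E) x = 0 := by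
      intro μ y
      have h := ((stdBasis (Module.End.eigenspace (T : E →ₗ[ℂ] E) μ)).hasSum_repr y).mapL
        (Module.End.eigenspace (T : E →ₗ[ℂ] E) μ).subtypeL
      have h2 := (h.mapL (innerSL ℂ x))
      have h3 : inner ℂ x (y : E) = 0 := by
        refine h2.unique ?_
        convert hasSum_zero with j
        have h4 := hx (w ⟨μ, j⟩) (Submodule.subset_span ⟨_, rfl⟩)
        rw [← inner_conj_symm, map_eq_zero] at h4
        simp only [map_smul, innerSL_apply_apply, Submodule.subtypeL_apply, smul_eq_mul]
        rw [show inner ℂ x ((stdBasis (Module.End.eigenspace (T : E →ₗ[ℂ] E) μ) j :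
          Module.End.eigenspace (T : E →ₗ[ℂ] E) μ) : E) = 0 from h4, mul_zero]
      rw [← inner_conj_symm, h3, map_zero]
    intro y hy
    have hle : (⨆ μ, Module.End.eigenspace (T : E →ₗ[ℂ] E) μ) ≤ (Submodule.span ℂ {x})ᗮ := by
      refine iSup_le fun μ z hz => ?_
      rw [Submodule.mem_orthogonal_singleton_iff_inner_left]
      exact key μ ⟨z, hz⟩
    exact (Submodule.mem_orthogonal_singleton_iff_inner_left).1 (hle hy)
  refine ⟨_, HilbertBasis.mkOfOrthogonalEqBot hw hbot, fun a => a.1, fun a => ?_⟩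
  rw [HilbertBasis.coe_mkOfOrthogonalEqBot]
  exact Module.End.mem_eigenspace_iff.1
    (stdBasis (Module.End.eigenspace (T : E →ₗ[ℂ] E) a.1) a.2).2

/-- The functions $g$ for which the formula holds form a closed subalgebra of $C(\sigma(T))$
containing the constants and the identity, hence everything by Stone–Weierstrass. -/
theorem cfc_apply_eigenvector {T : E →L[ℂ] E} (hT : IsSelfAdjoint T) {μ : ℝ} {v : E}
    (hv : v ≠ 0) (h : T v = (μ : ℂ) • v) (f : ℝ → ℝ) (hf : ContinuousOn f (spectrum ℝ T)) :
    cfc f T v = (f μ : ℂ) • v := by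
  have hμ : μ ∈ spectrum ℝ T := by
    rw [spectrum.mem_iff]
    intro hu
    obtain ⟨S, hS⟩ := hu
    have h1 : (S : E →L[ℂ] E) v = 0 := by
      rw [hS]
      simp [h, Algebra.algebraMap_eq_smul_one]
    have h2 : ((↑S⁻¹ * ↑S : E →L[ℂ] E)) v = v := by
      rw [S.inv_mul]; rfl
    rw [mul_apply_eq_comp, h1, map_zero] at h2
    exact hv h2.symm
  rw [cfc_apply f T hT hf]
  suffices H : ∀ g : C(spectrum ℝ T, ℝ), cfcHom hT g v = ((g ⟨μ, hμ⟩ : ℝ) : ℂ) • v from H _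
  have hid : cfcHom hT (.restrict (spectrum ℝ T) <| .id ℝ) v =
      (((ContinuousMap.restrict (spectrum ℝ T) (.id ℝ)) ⟨μ, hμ⟩ : ℝ) : ℂ) • v := by
    rw [cfcHom_id hT]
    simpa using h
  intro g
  induction g using ContinuousMap.induction_on_of_compact with
  | const r =>
    have : ContinuousMap.const (spectrum ℝ T) r = algebraMap ℝ C(spectrum ℝ T, ℝ) r := rfl
    rw [this, AlgHomClass.commutes]
    simp [Algebra.algebraMap_eq_smul_one]
  | id => exact hid
  | star_id => rw [star_trivial]; exact hid
  | add f g hf hg => simp [hf, hg, add_smul]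
  | mul f g hf hg =>
    rw [map_mul, mul_apply_eq_comp, hg, map_smul, hf, smul_smul, ContinuousMap.mul_apply,
      Complex.ofReal_mul, mul_comm]
  | frequently f hf =>
    have hcl : IsClosed {g : C(spectrum ℝ T, ℝ) |
        cfcHom hT g v = ((g ⟨μ, hμ⟩ : ℝ) : ℂ) • v} := by
      refine isClosed_eq ?_ ?_
      · exact (ContinuousLinearMap.apply ℂ E v).continuous.comp (cfcHom_continuous hT)
      · exact (Complex.continuous_ofReal.comp (continuous_eval_const _)).smul
          continuous_const
    exact hcl.closure_subset (mem_closure_iff_frequently.2 hf)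

theorem rpow_apply_eigenvector {T : E →L[ℂ] E} (hT : 0 ≤ T) {μ : ℝ} {v : E}
    (hv : v ≠ 0) (h : T v = (μ : ℂ) • v) {r : ℝ} (hr : 0 ≤ r) :
    (T ^ r : E →L[ℂ] E) v = ((μ ^ r : ℝ) : ℂ) • v := by
  rw [CFC.rpow_eq_cfc_real hT]
  exact cfc_apply_eigenvector hT.isSelfAdjoint hv h _
    (fun x _ => (Real.continuousAt_rpow_const x r (Or.inr hr)).continuousWithinAt)

/-- A positive operator with an eigenbasis: the eigenvalues are non-negative reals. -/
theorem exists_hilbertBasis_eigenvectors_of_nonneg {T : E →L[ℂ] E} (hT : IsCompactOperator T)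
    (hpos : 0 ≤ T) :
    ∃ (ι : Type u) (b : HilbertBasis ι ℂ E) (μ : ι → ℝ≥0),
      ∀ i, T (b i) = ((μ i : ℝ) : ℂ) • b i := by
  obtain ⟨ι, b, μ, h⟩ := exists_hilbertBasis_eigenvectors hT hpos.isSelfAdjoint
  have hμ : ∀ i, 0 ≤ μ i := fun i => by
    have h1 := ((ContinuousLinearMap.nonneg_iff_isPositive _).1 hpos).inner_nonneg_right (b i)
    rw [h, inner_smul_right, inner_self_eq_norm_sq_to_K, b.orthonormal.1] at h1
    simpa using h1
  refine ⟨ι, b, fun i => ⟨(μ i).re, (Complex.le_def.1 (hμ i)).1⟩, fun i => ?_⟩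
  rw [h]
  congr 1
  exact Complex.ext rfl (Complex.le_def.1 (hμ i)).2.symm

end Spectral

/-! ### Schmidt expansions and matrix coefficients -/

section Schmidt

variable {E F : Type u} [NormedAddCommGroup E] [InnerProductSpace ℂ E] [CompleteSpace E]
  [NormedAddCommGroup F] [InnerProductSpace ℂ F] [CompleteSpace F]

/-- `A` has a Schmidt representation `∑ s n ⟨v n, ·⟩ u n` with Bessel families `u`, `v` and
coefficients `s` in `ℓ^r`. -/
def HasSchmidtRep (r : ℝ) (A : E →L[ℂ] F) : Prop :=
  ∃ (ι : Type u) (s : ι → ℝ≥0) (v : ι → E) (w : ι → F), IsBessel v ∧ IsBessel w ∧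
    ∑' n, (s n : ℝ≥0∞) ^ r ≠ ∞ ∧
    ∀ x y, inner ℂ y (A x) = ∑' n, ((s n : ℝ) : ℂ) * (inner ℂ (v n) x * inner ℂ y (w n))

/-- The matrix coefficients of `A` along pairs of Bessel families are in `ℓ^r`. -/
def HasSummableCoeffs (r : ℝ) (A : E →L[ℂ] F) : Prop :=
  ∀ (κ : Type u) (e : κ → E) (f : κ → F), IsBessel e → IsBessel f →
    ∑' i, ‖inner ℂ (f i) (A (e i))‖ₑ ^ r ≠ ∞

theorem enorm_tsum_le {ι : Type*} (f : ι → ℂ) : ‖∑' i, f i‖ₑ ≤ ∑' i, ‖f i‖ₑ := by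
  by_cases h : ∑' i, ‖f i‖ₑ = ∞
  · rw [h]; exact le_top
  have h1 : Summable fun i => ‖f i‖₊ := ENNReal.tsum_coe_ne_top_iff_summable.1 h
  simp only [enorm_eq_nnnorm]
  rw [← ENNReal.coe_tsum h1]
  exact ENNReal.coe_le_coe.2 (nnnorm_tsum_le h1)

theorem summable_of_tsum_enorm_ne_top {ι : Type*} {V : Type*} [NormedAddCommGroup V]
    [CompleteSpace V] {f : ι → V} (h : ∑' i, ‖f i‖ₑ ≠ ∞) : Summable f := by
  have h1 : Summable fun i => ‖f i‖₊ := ENNReal.tsum_coe_ne_top_iff_summable.1 h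
  exact Summable.of_norm (by simpa using NNReal.summable_coe.2 h1)

theorem enorm_coe_nnreal (s : ℝ≥0) : ‖((s : ℝ) : ℂ)‖ₑ = s := by
  rw [← ofReal_norm]
  simp

omit [CompleteSpace E] [CompleteSpace F] in
theorem enorm_inner_le_of_rep {ι : Type u} {s : ι → ℝ≥0} {v : ι → E} {w : ι → F} {A : E →L[ℂ] F}
    (h : ∀ x y, inner ℂ y (A x) = ∑' n, ((s n : ℝ) : ℂ) * (inner ℂ (v n) x * inner ℂ y (w n)))
    (x : E) (y : F) :
    ‖inner ℂ y (A x)‖ₑ ≤ ∑' n, s n * (‖inner ℂ (v n) x‖ₑ * ‖inner ℂ (w n) y‖ₑ) := by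
  rw [h]
  refine (enorm_tsum_le _).trans (le_of_eq (tsum_congr fun n => ?_))
  rw [enorm_mul, enorm_mul, enorm_coe_nnreal, enorm_inner_symm y]

omit [CompleteSpace E] [CompleteSpace F] in
-- A Schur test: the kernel `W` has bounded row and column sums, so it maps $\ell^r$ to $\ell^r$
-- when $r\ge1$.
theorem HasSchmidtRep.hasSummableCoeffs {r : ℝ} (hr : 1 ≤ r) {A : E →L[ℂ] F}
    (hA : HasSchmidtRep r A) : HasSummableCoeffs r A := by
  intro κ e f he hf
  obtain ⟨ι, s, v, w, hv, hw, hs, hrep⟩ := hA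
  obtain ⟨K, hK⟩ := hv.exists_tsum_mul_le hw
  obtain ⟨L, hL⟩ := he.exists_tsum_mul_le hf
  obtain ⟨a, ha⟩ := he.exists_enorm_le
  obtain ⟨b, hb⟩ := hf.exists_enorm_le
  obtain ⟨c, hc⟩ := hv.exists_enorm_le
  obtain ⟨d, hd⟩ := hw.exists_enorm_le
  set W : κ → ι → ℝ≥0∞ := fun i n => ‖inner ℂ (v n) (e i)‖ₑ * ‖inner ℂ (w n) (f i)‖ₑ with hW
  have h1 : ∀ i, ∑' n, W i n ≤ K * (a * b) := fun i =>
    (hK (e i) (f i)).trans (by gcongr; exacts [ha i, hb i])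
  have h2 : ∀ n, ∑' i, W i n ≤ L * (c * d) := fun n => by
    simp only [hW]
    simp only [enorm_inner_symm (v n), enorm_inner_symm (w n)]
    exact (hL (v n) (w n)).trans (by gcongr; exacts [hc n, hd n])
  have h3 : ∀ i, ‖inner ℂ (f i) (A (e i))‖ₑ ^ r ≤
      (K * (a * b)) ^ (r - 1) * ∑' n, W i n * (s n : ℝ≥0∞) ^ r := fun i => by
    calc _ ≤ (∑' n, W i n * s n) ^ r := by
          gcongr
          refine (enorm_inner_le_of_rep hrep _ _).trans (le_of_eq (tsum_congr fun n => ?_))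
          rw [mul_comm]
      _ ≤ _ := ennreal_tsum_weight_rpow_le _ _ hr
      _ ≤ _ := by
          gcongr
          exact h1 i
  refine ne_top_of_le_ne_top (b := (K * (a * b) : ℝ≥0∞) ^ (r - 1) *
    ((∑' n, (s n : ℝ≥0∞) ^ r) * (L * (c * d)))) ?_ ?_
  · refine ENNReal.mul_ne_top (ENNReal.rpow_ne_top_of_nonneg (by linarith) (by finiteness))
      (ENNReal.mul_ne_top hs (by finiteness))
  · calc _ ≤ ∑' i, (K * (a * b) : ℝ≥0∞) ^ (r - 1) * ∑' n, W i n * (s n : ℝ≥0∞) ^ r :=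
          ENNReal.tsum_le_tsum h3
      _ = (K * (a * b) : ℝ≥0∞) ^ (r - 1) * ∑' n, (s n : ℝ≥0∞) ^ r * ∑' i, W i n := by
          rw [ENNReal.tsum_mul_left, ENNReal.tsum_comm]
          congr 1
          refine tsum_congr fun n => ?_
          rw [ENNReal.tsum_mul_right, mul_comm]
      _ ≤ _ := by
          rw [← ENNReal.tsum_mul_right]
          gcongr with n
          exact h2 n

theorem HasSchmidtRep.adjoint {r : ℝ} {A : E →L[ℂ] F} (hA : HasSchmidtRep r A) :
    HasSchmidtRep r (ContinuousLinearMap.adjoint A) := by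
  obtain ⟨ι, s, v, w, hv, hw, hs, hrep⟩ := hA
  refine ⟨ι, s, w, v, hw, hv, hs, fun x y => ?_⟩
  rw [ContinuousLinearMap.adjoint_inner_right, ← inner_conj_symm, hrep, Complex.conj_tsum]
  refine tsum_congr fun n => ?_
  simp only [map_mul, Complex.conj_ofReal, inner_conj_symm]
  ring

/-- The outer factors are absorbed into the families, as $C^*v_n$ and $Bw_n$. -/
theorem HasSchmidtRep.comp {E' F' : Type u} [NormedAddCommGroup E'] [InnerProductSpace ℂ E']
    [CompleteSpace E'] [NormedAddCommGroup F'] [InnerProductSpace ℂ F'] [CompleteSpace F']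
    {r : ℝ} {A : E →L[ℂ] F} (hA : HasSchmidtRep r A)
    (B : F →L[ℂ] F') (C : E' →L[ℂ] E) : HasSchmidtRep r (B ∘L A ∘L C) := by
  obtain ⟨ι, s, v, w, hv, hw, hs, hrep⟩ := hA
  refine ⟨ι, s, _, _, hv.map (ContinuousLinearMap.adjoint C), hw.map B, hs, fun x y => ?_⟩
  rw [ContinuousLinearMap.comp_apply, ContinuousLinearMap.comp_apply,
    ← ContinuousLinearMap.adjoint_inner_left, hrep]
  refine tsum_congr fun n => ?_
  rw [ContinuousLinearMap.adjoint_inner_left, ContinuousLinearMap.adjoint_inner_left]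

theorem ennreal_le_rpow_inv_of_tsum {ι : Type*} {s : ι → ℝ≥0∞} {r : ℝ} (hr : 0 < r) (n : ι) :
    s n ≤ (∑' n, s n ^ r) ^ r⁻¹ := by
  rw [ENNReal.le_rpow_inv_iff hr]
  exact ENNReal.le_tsum (f := fun n => s n ^ r) n

omit [CompleteSpace E] [CompleteSpace F] in
theorem HasSchmidtRep.mono {r t : ℝ} (hr : 0 < r) (hrt : r ≤ t) {A : E →L[ℂ] F}
    (hA : HasSchmidtRep r A) : HasSchmidtRep t A := by
  obtain ⟨ι, s, v, w, hv, hw, hs, hrep⟩ := hA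
  refine ⟨ι, s, v, w, hv, hw, ?_, hrep⟩
  -- `C` bounds every $s_n$, so that $s_n^t\le C^{t-r}s_n^r$.
  set C := (∑' n, (s n : ℝ≥0∞) ^ r) ^ r⁻¹
  have hC : C ≠ ∞ := ENNReal.rpow_ne_top_of_nonneg (by positivity) hs
  refine ne_top_of_le_ne_top (b := C ^ (t - r) * ∑' n, (s n : ℝ≥0∞) ^ r)
    (ENNReal.mul_ne_top (ENNReal.rpow_ne_top_of_nonneg (by linarith) hC) hs) ?_
  rw [← ENNReal.tsum_mul_left]
  refine ENNReal.tsum_le_tsum fun n => ?_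
  calc (s n : ℝ≥0∞) ^ t = (s n : ℝ≥0∞) ^ (t - r) * (s n : ℝ≥0∞) ^ r := by
        rw [← ENNReal.rpow_add_of_nonneg _ _ (by linarith) hr.le]; simp
    _ ≤ _ := by
        gcongr
        exact ennreal_le_rpow_inv_of_tsum (s := fun n => (s n : ℝ≥0∞)) hr n

omit [CompleteSpace E] in
-- Only finitely many coefficients exceed a given threshold, and the remaining tail is small in norm
-- by the Bessel bounds.
theorem HasSchmidtRep.isCompactOperator {r : ℝ} (hr : 0 < r) {A : E →L[ℂ] F}
    (hA : HasSchmidtRep r A) : IsCompactOperator A := by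
  obtain ⟨ι, s, v, w, hv, hw, hs, hrep⟩ := hA
  obtain ⟨K, hK⟩ := hv.exists_tsum_mul_le hw
  have hfin : ∀ ε : ℝ≥0, 0 < ε → {n | ε ≤ s n}.Finite := fun ε hε => by
    have h := ENNReal.finite_const_le_of_tsum_ne_top hs
      (ε := (ε : ℝ≥0∞) ^ r) (by simp [hε.ne', hr])
    refine h.subset fun n hn => ?_
    have : (ε : ℝ≥0∞) ≤ s n := by exact_mod_cast hn
    exact ENNReal.rpow_le_rpow this hr.le
  have hsum : ∀ x y, Summable fun n =>
      ((s n : ℝ) : ℂ) * (inner ℂ (v n) x * inner ℂ y (w n)) := fun x y => by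
    refine summable_of_tsum_enorm_ne_top (ne_top_of_le_ne_top
      (b := (∑' n, (s n : ℝ≥0∞) ^ r) ^ r⁻¹ * (K * (‖x‖ₑ * ‖y‖ₑ))) ?_ ?_)
    · exact ENNReal.mul_ne_top (ENNReal.rpow_ne_top_of_nonneg (by positivity) hs) (by finiteness)
    · refine le_trans ?_ (mul_le_mul_right (hK x y) _)
      rw [← ENNReal.tsum_mul_left]
      refine ENNReal.tsum_le_tsum fun n => ?_
      rw [enorm_mul, enorm_mul, enorm_coe_nnreal, enorm_inner_symm y]
      gcongr
      exact ennreal_le_rpow_inv_of_tsum (s := fun n => (s n : ℝ≥0∞)) hr n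
  refine isCompactOperator_of_approx fun ε hε => ?_
  lift ε to ℝ≥0 using hε.le
  -- The tail is bounded by $\delta K\le\varepsilon$; the $+1$ guards against $K=0$.
  set δ : ℝ≥0 := ε / (K + 1) with hδ
  have hδ0 : 0 < δ := div_pos (by exact_mod_cast hε) (by positivity)
  set S := (hfin δ hδ0).toFinset with hS
  refine ⟨∑ n ∈ S, rankOneOp (v n) (((s n : ℝ) : ℂ) • w n),
    isCompactOperator_sum _ _ fun _ _ => isCompactOperator_rankOneOp _ _, fun x y => ?_⟩
  have h1 : inner ℂ y ((A - ∑ n ∈ S, rankOneOp (v n) (((s n : ℝ) : ℂ) • w n)) x) =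
      ∑' n : {n // n ∉ S}, ((s n : ℝ) : ℂ) * (inner ℂ (v n) x * inner ℂ y (w n)) := by
    rw [sub_apply, inner_sub_right, hrep, ← (hsum x y).sum_add_tsum_subtype_compl S,
      sum_apply, inner_sum]
    rw [sub_eq_iff_eq_add']
    congr 1
    refine Finset.sum_congr rfl fun n _ => ?_
    rw [rankOneOp_apply, inner_smul_right, inner_smul_right]
    ring
  have h2 : ‖inner ℂ y ((A - ∑ n ∈ S, rankOneOp (v n) (((s n : ℝ) : ℂ) • w n)) x)‖ₑ ≤
      (δ * K : ℝ≥0) * ‖x‖ₑ * ‖y‖ₑ := by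
    rw [h1]
    refine (enorm_tsum_le _).trans ?_
    calc _ ≤ ∑' n : {n // n ∉ S}, δ * (‖inner ℂ (v n) x‖ₑ * ‖inner ℂ (w n) y‖ₑ) := by
          refine ENNReal.tsum_le_tsum fun n => ?_
          rw [enorm_mul, enorm_mul, enorm_coe_nnreal, enorm_inner_symm y]
          gcongr
          have := n.2
          simp only [hS, Set.Finite.mem_toFinset, Set.mem_ofPred_eq, not_le] at this
          exact this.le
      _ ≤ ∑' n, δ * (‖inner ℂ (v n) x‖ₑ * ‖inner ℂ (w n) y‖ₑ) :=
          ENNReal.tsum_comp_le_tsum_of_injective Subtype.val_injective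
            (fun n => δ * (‖inner ℂ (v n) x‖ₑ * ‖inner ℂ (w n) y‖ₑ))
      _ ≤ _ := by
          rw [ENNReal.tsum_mul_left, ENNReal.coe_mul, mul_assoc, mul_assoc]
          gcongr
          exact hK x y
  have h3 : ‖inner ℂ y ((A - ∑ n ∈ S, rankOneOp (v n) (((s n : ℝ) : ℂ) • w n)) x)‖ ≤
      (δ * K : ℝ≥0) * ‖x‖ * ‖y‖ := by
    simp only [enorm_eq_nnnorm] at h2
    exact_mod_cast h2
  refine h3.trans ?_
  gcongr
  rw [hδ, div_mul_eq_mul_div, div_le_iff₀ (by positivity)]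
  gcongr
  exact le_self_add

end Schmidt

/-! ### Nuclear expansions and their trace -/

section Nuclear

variable {E F : Type u} [NormedAddCommGroup E] [InnerProductSpace ℂ E] [CompleteSpace E]
  [NormedAddCommGroup F] [InnerProductSpace ℂ F] [CompleteSpace F]

/-- The weak expansion `X = ∑ ⟨a n, ·⟩ b n` with `∑ ‖a n‖ ‖b n‖ < ∞`. -/
structure IsNuclearRep {ι : Type*} (a : ι → E) (b : ι → F) (X : E →L[ℂ] F) : Prop where
  tsum_ne_top : ∑' n, ‖a n‖ₑ * ‖b n‖ₑ ≠ ∞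
  inner_eq : ∀ x y, inner ℂ y (X x) = ∑' n, inner ℂ (a n) x * inner ℂ y (b n)

omit [CompleteSpace E] in
theorem IsNuclearRep.isCompactOperator {ι : Type*} {a : ι → E} {b : ι → F} {X : E →L[ℂ] F}
    (h : IsNuclearRep a b X) : IsCompactOperator X := by
  have hsum : Summable fun n => rankOneOp (a n) (b n) := by
    refine summable_of_tsum_enorm_ne_top (ne_of_eq_of_ne (tsum_congr fun n => ?_) h.tsum_ne_top)
    rw [← ofReal_norm, norm_rankOneOp, ENNReal.ofReal_mul (norm_nonneg _), ofReal_norm,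
      ofReal_norm]
  have hX : X = ∑' n, rankOneOp (a n) (b n) := by
    ext x
    refine ext_inner_left ℂ fun y => ?_
    have h1 : HasSum (fun n => inner ℂ (a n) x * inner ℂ y (b n))
        (inner ℂ y ((∑' n, rankOneOp (a n) (b n)) x)) := by
      have h2 := (hsum.hasSum.mapL (ContinuousLinearMap.apply ℂ F x)).mapL (innerSL ℂ y)
      simpa [rankOneOp_apply, inner_smul_right] using h2
    rw [h.inner_eq, h1.tsum_eq]
  have hcl : IsClosed {f : E →L[ℂ] F | IsCompactOperator f} :=
    isClosed_setOfPred_isCompactOperator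
  have hs : HasSum (fun n => rankOneOp (a n) (b n)) X := hX ▸ hsum.hasSum
  exact hcl.mem_of_tendsto hs (Filter.Eventually.of_forall fun s =>
    isCompactOperator_sum _ _ fun _ _ => isCompactOperator_rankOneOp _ _)

omit [CompleteSpace E] [CompleteSpace F] in
theorem IsNuclearRep.hasSummableCoeffs {ι : Type*} {a : ι → E} {b : ι → F} {X : E →L[ℂ] F}
    (h : IsNuclearRep a b X) : HasSummableCoeffs 1 X := by
  intro κ e f he hf
  obtain ⟨L, hL⟩ := he.exists_tsum_mul_le hf
  simp only [ENNReal.rpow_one]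
  refine ne_top_of_le_ne_top (b := L * ∑' n, ‖a n‖ₑ * ‖b n‖ₑ)
    (ENNReal.mul_ne_top ENNReal.coe_ne_top h.tsum_ne_top) ?_
  calc _ ≤ ∑' i, ∑' n, ‖inner ℂ (e i) (a n)‖ₑ * ‖inner ℂ (f i) (b n)‖ₑ := by
        refine ENNReal.tsum_le_tsum fun i => ?_
        rw [h.inner_eq]
        refine (enorm_tsum_le _).trans (le_of_eq (tsum_congr fun n => ?_))
        rw [enorm_mul, enorm_inner_symm (a n)]
    _ = ∑' n, ∑' i, ‖inner ℂ (e i) (a n)‖ₑ * ‖inner ℂ (f i) (b n)‖ₑ := ENNReal.tsum_comm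
    _ ≤ _ := by
        rw [← ENNReal.tsum_mul_left]
        exact ENNReal.tsum_le_tsum fun n => hL _ _

/-- The trace of a nuclear operator, computed from any of its nuclear expansions. -/
theorem IsNuclearRep.trace_eq {ι : Type*} {a b : ι → E} {X : E →L[ℂ] E}
    (h : IsNuclearRep a b X) : trace X = ∑' n, inner ℂ (a n) (b n) := by
  obtain ⟨L, hL⟩ := (isBessel_hilbertBasis (stdBasis E)).exists_tsum_mul_le
    (isBessel_hilbertBasis (stdBasis E))
  -- Absolute summability over both indices justifies exchanging the sums; Parseval then evaluates
  -- the inner one.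
  have hsum : Summable (Function.uncurry fun n i =>
      inner ℂ (a n) (stdBasis E i) * inner ℂ (stdBasis E i) (b n)) := by
    refine summable_of_tsum_enorm_ne_top (ne_top_of_le_ne_top
      (b := L * ∑' n, ‖a n‖ₑ * ‖b n‖ₑ)
      (ENNReal.mul_ne_top ENNReal.coe_ne_top h.tsum_ne_top) ?_)
    rw [ENNReal.tsum_prod', ← ENNReal.tsum_mul_left]
    refine ENNReal.tsum_le_tsum fun n => le_trans (le_of_eq (tsum_congr fun i => ?_))
      (hL (a n) (b n))
    rw [Function.uncurry_apply_pair, enorm_mul, enorm_inner_symm (a n)]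
  unfold trace
  calc _ = ∑' i, ∑' n, inner ℂ (a n) (stdBasis E i) * inner ℂ (stdBasis E i) (b n) :=
        tsum_congr fun i => h.inner_eq _ _
    _ = ∑' n, ∑' i, inner ℂ (a n) (stdBasis E i) * inner ℂ (stdBasis E i) (b n) := hsum.tsum_comm
    _ = _ := tsum_congr fun n => (stdBasis E).tsum_inner_mul_inner _ _

end Nuclear

/-! ### Schatten classes through singular values -/

section SchattenChar

variable {E F : Type u} [NormedAddCommGroup E] [InnerProductSpace ℂ E] [CompleteSpace E]
  [NormedAddCommGroup F] [InnerProductSpace ℂ F] [CompleteSpace F]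

theorem adjoint_comp_self_nonneg (A : E →L[ℂ] F) : 0 ≤ ContinuousLinearMap.adjoint A ∘L A := by
  rw [ContinuousLinearMap.nonneg_iff_isPositive]
  exact ContinuousLinearMap.isPositive_adjoint_comp_self A

/-- Singular vectors: an eigenbasis of `A* A` yields a Bessel family of left singular vectors. -/
theorem exists_left_singular_vectors {ι : Type u} (A : E →L[ℂ] F) (b : HilbertBasis ι ℂ E)
    (s : ι → ℝ≥0)
    (h : ∀ i, (ContinuousLinearMap.adjoint A ∘L A) (b i) = (((s i : ℝ) ^ 2 : ℝ) : ℂ) • b i) :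
    ∃ w : ι → F, IsBessel w ∧ (∀ i, A (b i) = ((s i : ℝ) : ℂ) • w i) ∧
      (∀ i, inner ℂ (w i) (A (b i)) = ((s i : ℝ) : ℂ)) ∧
      ∀ x y, inner ℂ y (A x) = ∑' n, ((s n : ℝ) : ℂ) * (inner ℂ (b n) x * inner ℂ y (w n)) := by
  classical
  have hin : ∀ i j, inner ℂ (A (b i)) (A (b j)) =
      if i = j then (((s j : ℝ) ^ 2 : ℝ) : ℂ) else 0 := by
    intro i j
    rw [← ContinuousLinearMap.adjoint_inner_right, ← ContinuousLinearMap.comp_apply, h,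
      inner_smul_right, orthonormal_iff_ite.1 b.orthonormal]
    simp
  have h0 : ∀ i, s i = 0 → A (b i) = 0 := fun i hi => by
    have := hin i i
    simpa [hi] using this
  -- Since $0^{-1}=0$, $w_i$ vanishes where $s_i=0$; the others are orthonormal.
  set w : ι → F := fun i => ((s i : ℝ) : ℂ)⁻¹ • A (b i) with hw
  have hAw : ∀ i, A (b i) = ((s i : ℝ) : ℂ) • w i := fun i => by
    by_cases hi : s i = 0
    · rw [h0 i hi, hi]; simp
    · have : ((s i : ℝ) : ℂ) ≠ 0 := by simpa using hi
      rw [hw, smul_smul, mul_inv_cancel₀ this, one_smul]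
  refine ⟨w, isBessel_of_orthonormal_support ?_, hAw, fun i => ?_, fun x y => ?_⟩
  · rw [orthonormal_iff_ite]
    rintro ⟨i, hi⟩ ⟨j, hj⟩
    have hsi : ((s i : ℝ) : ℂ) ≠ 0 := fun h1 => hi (by simp [hw, h1])
    simp only [hw, inner_smul_left, inner_smul_right, hin, Subtype.mk.injEq]
    split_ifs with hij
    · subst hij
      simp only [map_inv₀, Complex.conj_ofReal]
      push_cast
      field_simp
    · simp
  · by_cases hi : s i = 0
    · rw [h0 i hi, hi]; simp
    · have : ((s i : ℝ) : ℂ) ≠ 0 := by simpa using hi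
      simp only [hw, inner_smul_left, hin, if_true, map_inv₀, Complex.conj_ofReal]
      push_cast
      field_simp
  · rw [← ContinuousLinearMap.adjoint_inner_left, ← b.tsum_inner_mul_inner]
    refine tsum_congr fun n => ?_
    rw [ContinuousLinearMap.adjoint_inner_left, hAw, inner_smul_right]
    ring

/-- Compactness is not assumed but deduced: $P=|A|^r$ has finite trace, hence is nuclear and has an
eigenbasis, which also diagonalises $A^*A=P^{2/r}$. -/
theorem hasSchmidtRep_of_posTrace {r : ℝ} (hr : 0 < r) {A : E →L[ℂ] F}
    (h : posTrace ((ContinuousLinearMap.adjoint A ∘L A) ^ (r / 2)) < ∞) : HasSchmidtRep r A := by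
  set P := (ContinuousLinearMap.adjoint A ∘L A) ^ (r / 2) with hP
  have hP0 : 0 ≤ P := CFC.rpow_nonneg
  obtain ⟨R, hR, hRP⟩ : ∃ R : E →L[ℂ] E, IsSelfAdjoint R ∧ R * R = P :=
    ⟨CFC.sqrt P, (CFC.sqrt_nonneg P).isSelfAdjoint, CFC.sqrt_mul_sqrt_self P hP0⟩
  have hsymm : ∀ x y : E, inner ℂ (R x) y = inner ℂ x (R y) := fun x y => by
    rw [← ContinuousLinearMap.adjoint_inner_right, hR.adjoint_eq]
  -- With $R=P^{1/2}$, $P=\sum\langle Re_i,\cdot\rangle Re_i$ and $\sum\|Re_i\|^2=\mathrm{Tr}\,P$.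
  have hnuc : IsNuclearRep (fun i => R (stdBasis E i)) (fun i => R (stdBasis E i)) P := by
    refine ⟨?_, fun x y => ?_⟩
    · refine ne_of_eq_of_ne (tsum_congr fun i => ?_) h.ne
      rw [← hRP, mul_apply_eq_comp, ← hsymm, ← sq, ← ofReal_norm,
        ← ENNReal.ofReal_pow (norm_nonneg _)]
      congr 1
      exact norm_sq_eq_re_inner (𝕜 := ℂ) _
    · rw [← hRP, mul_apply_eq_comp, ← hsymm, ← (stdBasis E).tsum_inner_mul_inner]
      refine tsum_congr fun i => ?_
      rw [hsymm, hsymm, mul_comm]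
  obtain ⟨ι, b, μ, hμ⟩ := exists_hilbertBasis_eigenvectors_of_nonneg hnuc.isCompactOperator hP0
  have hroot : P ^ (2 / r) = ContinuousLinearMap.adjoint A ∘L A := by
    rw [hP, CFC.rpow_rpow_of_exponent_nonneg _ _ _ (by positivity) (by positivity)
      (adjoint_comp_self_nonneg A)]
    rw [show r / 2 * (2 / r) = 1 by field_simp, CFC.rpow_one _ (adjoint_comp_self_nonneg A)]
  have hs : ∀ i, (ContinuousLinearMap.adjoint A ∘L A) (b i) =
      ((((μ i ^ (1 / r) : ℝ≥0) : ℝ) ^ 2 : ℝ) : ℂ) • b i := fun i => by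
    rw [← hroot, rpow_apply_eigenvector hP0 (b.orthonormal.ne_zero i) (hμ i) (by positivity)]
    congr 2
    rw [NNReal.coe_rpow, ← Real.rpow_natCast, ← Real.rpow_mul (μ i).coe_nonneg]
    congr 1
    push_cast
    ring
  obtain ⟨w, hw, -, -, hrep⟩ := exists_left_singular_vectors A b _ hs
  refine ⟨ι, _, b, w, isBessel_hilbertBasis b, hw, ?_, hrep⟩
  refine ne_of_eq_of_ne (tsum_congr fun i => ?_) (posTrace_eq b P hP0 ▸ h.ne)
  rw [hμ, inner_smul_right, inner_self_eq_norm_sq_to_K, b.orthonormal.1,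
    ← ENNReal.coe_rpow_of_nonneg _ hr.le, ← NNReal.rpow_mul]
  simp [hr.ne']

/-- Along the right and left singular vectors the matrix coefficients are the singular values
themselves. -/
theorem posTrace_of_hasSummableCoeffs {r : ℝ} (hr : 0 < r) {A : E →L[ℂ] F}
    (hc : IsCompactOperator A) (h : HasSummableCoeffs r A) :
    posTrace ((ContinuousLinearMap.adjoint A ∘L A) ^ (r / 2)) < ∞ := by
  have h0 := adjoint_comp_self_nonneg A
  obtain ⟨ι, b, μ, hμ⟩ := exists_hilbertBasis_eigenvectors_of_nonneg
    (T := ContinuousLinearMap.adjoint A ∘L A) (show IsCompactOperator (_ ∘ _) from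
      hc.clm_comp (ContinuousLinearMap.adjoint A)) h0
  have hs : ∀ i, (ContinuousLinearMap.adjoint A ∘L A) (b i) =
      (((NNReal.sqrt (μ i) : ℝ) ^ 2 : ℝ) : ℂ) • b i := fun i => by
    rw [hμ]
    congr 2
    rw [← NNReal.coe_pow, NNReal.sq_sqrt]
  obtain ⟨w, hw, -, hin, -⟩ := exists_left_singular_vectors A b _ hs
  rw [posTrace_eq b _ CFC.rpow_nonneg, lt_top_iff_ne_top]
  refine ne_of_eq_of_ne (tsum_congr fun i => ?_) (h ι b w (isBessel_hilbertBasis b) hw)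
  rw [hin, rpow_apply_eigenvector h0 (b.orthonormal.ne_zero i) (hμ i) (by positivity),
    inner_smul_right, inner_self_eq_norm_sq_to_K, b.orthonormal.1, enorm_coe_nnreal,
    ← ENNReal.coe_rpow_of_nonneg _ hr.le]
  rw [← NNReal.coe_rpow]
  simp only [Complex.coe_algebraMap, Complex.ofReal_one, one_pow, mul_one, Complex.ofReal_re,
    ENNReal.ofReal_coe_nnreal]
  rw [NNReal.sqrt_eq_rpow, ← NNReal.rpow_mul]
  congr 2
  ring

end SchattenChar

/-! ### Schatten classes as operator ideals -/

section SchattenIdeal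

variable {E F : Type u} [NormedAddCommGroup E] [InnerProductSpace ℂ E] [CompleteSpace E]
  [NormedAddCommGroup F] [InnerProductSpace ℂ F] [CompleteSpace F] {p q : ℝ≥0∞}

theorem isSchatten_top {A : E →L[ℂ] F} : IsSchatten ∞ A ↔ IsCompactOperator A := by
  simp [IsSchatten]

theorem one_le_toReal (hp : 1 ≤ p) (hp' : p ≠ ∞) : 1 ≤ p.toReal := by
  simpa using ENNReal.toReal_mono hp' hp

theorem isSchatten_iff_hasSchmidtRep (hp : 1 ≤ p) (hp' : p ≠ ∞) {A : E →L[ℂ] F} :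
    IsSchatten p A ↔ HasSchmidtRep p.toReal A := by
  have h1 := one_le_toReal hp hp'
  refine ⟨fun h => hasSchmidtRep_of_posTrace (by linarith) (h.2 hp'), fun h =>
    ⟨fun h' => absurd h' hp', fun _ => posTrace_of_hasSummableCoeffs (by linarith)
      (h.isCompactOperator (by linarith))
      (h.hasSummableCoeffs h1)⟩⟩

theorem IsSchatten.isCompactOperator (hp : 1 ≤ p) {A : E →L[ℂ] F} (h : IsSchatten p A) :
    IsCompactOperator A := by
  by_cases hp' : p = ∞
  · exact h.1 hp'
  · have h1 := one_le_toReal hp hp'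
    exact ((isSchatten_iff_hasSchmidtRep hp hp').1 h).isCompactOperator (by linarith)

theorem isSchatten_iff_hasSummableCoeffs (hp : 1 ≤ p) (hp' : p ≠ ∞) {A : E →L[ℂ] F} :
    IsSchatten p A ↔ IsCompactOperator A ∧ HasSummableCoeffs p.toReal A := by
  have h1 := one_le_toReal hp hp'
  refine ⟨fun h => ⟨h.isCompactOperator hp,
    ((isSchatten_iff_hasSchmidtRep hp hp').1 h).hasSummableCoeffs h1⟩, fun h =>
    ⟨fun h' => absurd h' hp', fun _ => posTrace_of_hasSummableCoeffs (by linarith) h.1 h.2⟩⟩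

omit [CompleteSpace E] [CompleteSpace F] in
theorem HasSummableCoeffs.add {r : ℝ} (hr : 1 ≤ r) {A B : E →L[ℂ] F} (hA : HasSummableCoeffs r A)
    (hB : HasSummableCoeffs r B) : HasSummableCoeffs r (A + B) := by
  intro κ e f he hf
  refine ne_top_of_le_ne_top (b := (2 : ℝ≥0∞) ^ (r - 1) *
    (∑' i, ‖inner ℂ (f i) (A (e i))‖ₑ ^ r + ∑' i, ‖inner ℂ (f i) (B (e i))‖ₑ ^ r))
    (ENNReal.mul_ne_top (ENNReal.rpow_ne_top_of_nonneg (by linarith) (by finiteness))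
      (ENNReal.add_ne_top.2 ⟨hA κ e f he hf, hB κ e f he hf⟩)) ?_
  rw [← ENNReal.tsum_add, ← ENNReal.tsum_mul_left]
  refine ENNReal.tsum_le_tsum fun i => ?_
  rw [add_apply, inner_add_right]
  refine le_trans ?_ (ENNReal.rpow_add_le_mul_rpow_add_rpow _ _ hr)
  gcongr
  exact enorm_add_le _ _

theorem IsSchatten.add (hp : 1 ≤ p) {A B : E →L[ℂ] F} (hA : IsSchatten p A)
    (hB : IsSchatten p B) : IsSchatten p (A + B) := by
  by_cases hp' : p = ∞
  · subst hp'
    rw [isSchatten_top] at *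
    exact IsCompactOperator.add hA hB
  · rw [isSchatten_iff_hasSummableCoeffs hp hp'] at *
    exact ⟨IsCompactOperator.add hA.1 hB.1, hA.2.add (one_le_toReal hp hp') hB.2⟩

theorem IsSchatten.comp {E' F' : Type u} [NormedAddCommGroup E'] [InnerProductSpace ℂ E']
    [CompleteSpace E'] [NormedAddCommGroup F'] [InnerProductSpace ℂ F'] [CompleteSpace F']
    (hp : 1 ≤ p) {A : E →L[ℂ] F} (hA : IsSchatten p A)
    (B : F →L[ℂ] F') (C : E' →L[ℂ] E) : IsSchatten p (B ∘L A ∘L C) := by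
  by_cases hp' : p = ∞
  · subst hp'
    rw [isSchatten_top] at *
    exact (hA.comp_clm C).clm_comp B
  · rw [isSchatten_iff_hasSchmidtRep hp hp'] at *
    exact hA.comp B C

theorem IsSchatten.clm_comp {F' : Type u} [NormedAddCommGroup F'] [InnerProductSpace ℂ F']
    [CompleteSpace F'] (hp : 1 ≤ p) {A : E →L[ℂ] F} (hA : IsSchatten p A) (B : F →L[ℂ] F') :
    IsSchatten p (B ∘L A) :=
  hA.comp hp B (ContinuousLinearMap.id ℂ E)

theorem IsSchatten.comp_clm {E' : Type u} [NormedAddCommGroup E'] [InnerProductSpace ℂ E']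
    [CompleteSpace E'] (hp : 1 ≤ p) {A : E →L[ℂ] F} (hA : IsSchatten p A) (C : E' →L[ℂ] E) :
    IsSchatten p (A ∘L C) :=
  hA.comp hp (ContinuousLinearMap.id ℂ F) C

theorem IsSchatten.smul (hp : 1 ≤ p) {A : E →L[ℂ] F} (hA : IsSchatten p A) (c : ℂ) :
    IsSchatten p (c • A) := by
  convert hA.clm_comp hp (c • ContinuousLinearMap.id ℂ F) using 1
  ext x
  simp

theorem IsSchatten.of_one (hq : 1 ≤ q) {A : E →L[ℂ] F} (hA : IsSchatten 1 A) :
    IsSchatten q A := by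
  by_cases hq' : q = ∞
  · subst hq'
    exact isSchatten_top.2 (hA.isCompactOperator le_rfl)
  · rw [isSchatten_iff_hasSchmidtRep le_rfl (by simp)] at hA
    rw [isSchatten_iff_hasSchmidtRep hq hq']
    exact hA.mono (by simp) (by simpa using one_le_toReal hq hq')

theorem IsNuclearRep.isSchatten {ι : Type*} {a : ι → E} {b : ι → F} {X : E →L[ℂ] F}
    (h : IsNuclearRep a b X) : IsSchatten 1 X := by
  rw [isSchatten_iff_hasSummableCoeffs le_rfl (by simp)]
  exact ⟨h.isCompactOperator, by simpa using h.hasSummableCoeffs⟩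

theorem summable_trace {A : E →L[ℂ] E} (hA : IsSchatten 1 A) :
    Summable fun i => inner ℂ (stdBasis E i) (A (stdBasis E i)) := by
  rw [isSchatten_iff_hasSummableCoeffs le_rfl (by simp)] at hA
  have h := hA.2 _ _ _ (isBessel_hilbertBasis (stdBasis E)) (isBessel_hilbertBasis (stdBasis E))
  simp only [ENNReal.toReal_one, ENNReal.rpow_one] at h
  exact summable_of_tsum_enorm_ne_top h

theorem trace_add {A B : E →L[ℂ] E} (hA : IsSchatten 1 A) (hB : IsSchatten 1 B) :
    trace (A + B) = trace A + trace B := by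
  unfold trace
  rw [← (summable_trace hA).tsum_add (summable_trace hB)]
  simp

end SchattenIdeal

/-! ### Hölder's inequality and cyclicity of the trace -/

section Holder

variable {E F : Type u} [NormedAddCommGroup E] [InnerProductSpace ℂ E] [CompleteSpace E]
  [NormedAddCommGroup F] [InnerProductSpace ℂ F] [CompleteSpace F]

omit [CompleteSpace E] [CompleteSpace F] in
-- The estimate $\|Sx\|^2\le D\sum_m|\langle v_m,x\rangle|^2t_m^2$ is raised to the power $r/2$ by
-- Jensen, which is where $r\ge2$ enters, and then summed over $x=e_i$.
theorem HasSchmidtRep.tsum_enorm_apply_rpow_ne_top {r : ℝ} (hr : 2 ≤ r) {S : E →L[ℂ] F}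
    (hS : HasSchmidtRep r S) {κ : Type*} {e : κ → E} (he : IsBessel e) :
    ∑' i, ‖S (e i)‖ₑ ^ r ≠ ∞ := by
  obtain ⟨ι, t, v, w, hv, ⟨D, hD⟩, ht, hrep⟩ := hS
  obtain ⟨c, hc⟩ := hv.exists_enorm_le
  obtain ⟨C, hC⟩ := hv
  obtain ⟨a, ha⟩ := he.exists_enorm_le
  obtain ⟨L, hL⟩ := he
  have hsq : ∀ x, ‖S x‖ₑ ^ 2 ≤ D * ∑' m, ‖inner ℂ (v m) x‖ₑ ^ 2 * (t m : ℝ≥0∞) ^ 2 := by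
    intro x
    set Q := ∑' m, ‖inner ℂ (v m) x‖ₑ ^ 2 * (t m : ℝ≥0∞) ^ 2 with hQ
    -- Cauchy–Schwarz in the expansion of $\langle Sx,Sx\rangle$; squaring and cancelling $\|Sx\|^2$
    -- gives the claim.
    have h1 : ‖S x‖ₑ ^ 2 ≤ Q ^ (1 / 2 : ℝ) * (D * ‖S x‖ₑ ^ 2) ^ (1 / 2 : ℝ) := by
      rw [← enorm_inner_self]
      calc _ ≤ ∑' m, (‖inner ℂ (v m) x‖ₑ * t m) * ‖inner ℂ (w m) (S x)‖ₑ :=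
            (enorm_inner_le_of_rep hrep x (S x)).trans
              (le_of_eq (tsum_congr fun m => by ring))
        _ ≤ _ := ennreal_inner_le_Lp_mul_Lq_tsum _ _ Real.HolderConjugate.two_two
        _ ≤ _ := by
            simp only [ENNReal.rpow_two, mul_pow, enorm_inner_self]
            gcongr
            exact hD _
    by_cases h0 : ‖S x‖ₑ = 0
    · simp [h0]
    have h2 : ‖S x‖ₑ ^ 2 * ‖S x‖ₑ ^ 2 ≤ (D * Q) * ‖S x‖ₑ ^ 2 := by
      have hs : ∀ z : ℝ≥0∞, (z ^ (1 / 2 : ℝ)) ^ 2 = z := fun z => by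
        rw [← ENNReal.rpow_two, ← ENNReal.rpow_mul]; norm_num
      calc _ = (‖S x‖ₑ ^ 2) ^ 2 := by ring
        _ ≤ (Q ^ (1 / 2 : ℝ) * (D * ‖S x‖ₑ ^ 2) ^ (1 / 2 : ℝ)) ^ 2 := by gcongr
        _ = _ := by rw [mul_pow, hs, hs]; ring
    exact (ENNReal.mul_le_mul_iff_left (by simpa using h0)
      (ENNReal.pow_ne_top enorm_ne_top)).1 h2
  have hr2 : 1 ≤ r / 2 := by linarith
  have hpow : ∀ z : ℝ≥0∞, (z ^ 2) ^ (r / 2) = z ^ r := fun z => by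
    rw [← ENNReal.rpow_two, ← ENNReal.rpow_mul]; congr 1; ring
  set M : ℝ≥0∞ := (D : ℝ≥0∞) ^ (r / 2) * (C * a ^ 2) ^ (r / 2 - 1)
  have hM : M ≠ ∞ := ENNReal.mul_ne_top
    (ENNReal.rpow_ne_top_of_nonneg (by linarith) (by finiteness))
    (ENNReal.rpow_ne_top_of_nonneg (by linarith) (by finiteness))
  have hterm : ∀ i, ‖S (e i)‖ₑ ^ r ≤
      M * ∑' m, ‖inner ℂ (v m) (e i)‖ₑ ^ 2 * (t m : ℝ≥0∞) ^ r := fun i => by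
    calc _ = (‖S (e i)‖ₑ ^ 2) ^ (r / 2) := (hpow _).symm
      _ ≤ (D * ∑' m, ‖inner ℂ (v m) (e i)‖ₑ ^ 2 * (t m : ℝ≥0∞) ^ 2) ^ (r / 2) := by
          gcongr
          exact hsq _
      _ = (D : ℝ≥0∞) ^ (r / 2) * (∑' m, ‖inner ℂ (v m) (e i)‖ₑ ^ 2 * (t m : ℝ≥0∞) ^ 2) ^ (r / 2) :=
          ENNReal.mul_rpow_of_nonneg _ _ (by linarith)
      _ ≤ (D : ℝ≥0∞) ^ (r / 2) * ((∑' m, ‖inner ℂ (v m) (e i)‖ₑ ^ 2) ^ (r / 2 - 1) *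
            ∑' m, ‖inner ℂ (v m) (e i)‖ₑ ^ 2 * ((t m : ℝ≥0∞) ^ 2) ^ (r / 2)) := by
          gcongr
          exact ennreal_tsum_weight_rpow_le _ _ hr2
      _ ≤ _ := by
          rw [← mul_assoc]
          simp only [hpow, M]
          gcongr
          refine (hC _).trans ?_
          gcongr
          exact ha i
  refine ne_top_of_le_ne_top (b := M * ((∑' m, (t m : ℝ≥0∞) ^ r) * (L * c ^ 2)))
    (ENNReal.mul_ne_top hM (ENNReal.mul_ne_top ht (by finiteness))) ?_
  calc _ ≤ ∑' i, M * ∑' m, ‖inner ℂ (v m) (e i)‖ₑ ^ 2 * (t m : ℝ≥0∞) ^ r :=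
        ENNReal.tsum_le_tsum hterm
    _ = M * ∑' m, (t m : ℝ≥0∞) ^ r * ∑' i, ‖inner ℂ (e i) (v m)‖ₑ ^ 2 := by
        rw [ENNReal.tsum_mul_left, ENNReal.tsum_comm]
        congr 1
        refine tsum_congr fun m => ?_
        simp only [enorm_inner_symm (v m)]
        rw [ENNReal.tsum_mul_right, mul_comm]
    _ ≤ _ := by
        rw [← ENNReal.tsum_mul_right]
        gcongr with m
        refine (hL _).trans ?_
        gcongr
        exact hc m

/-- Both products of `S` and `T` are trace class, and they have the same trace. -/
structure TraceCommutes (S : F →L[ℂ] E) (T : E →L[ℂ] F) : Prop where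
  left : IsSchatten 1 (S ∘L T)
  right : IsSchatten 1 (T ∘L S)
  trace_eq : trace (S ∘L T) = trace (T ∘L S)

theorem TraceCommutes.symm {S : F →L[ℂ] E} {T : E →L[ℂ] F} (h : TraceCommutes S T) :
    TraceCommutes T S :=
  ⟨h.right, h.left, h.trace_eq.symm⟩

theorem traceCommutes_of_tsum_ne_top {ι : Type*} {s : ι → ℝ≥0} {v : ι → E} {w : ι → F}
    {T : E →L[ℂ] F} (S : F →L[ℂ] E)
    (hrep : ∀ x y, inner ℂ y (T x) = ∑' n, ((s n : ℝ) : ℂ) * (inner ℂ (v n) x * inner ℂ y (w n)))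
    (hv : IsBessel v) (hw : IsBessel w)
    (h1 : ∑' n, s n * ‖S (w n)‖ₑ ≠ ∞)
    (h2 : ∑' n, s n * ‖ContinuousLinearMap.adjoint S (v n)‖ₑ ≠ ∞) : TraceCommutes S T := by
  obtain ⟨c, hc⟩ := hv.exists_enorm_le
  obtain ⟨d, hd⟩ := hw.exists_enorm_le
  have hST : IsNuclearRep v (fun n => ((s n : ℝ) : ℂ) • S (w n)) (S ∘L T) := by
    refine ⟨ne_top_of_le_ne_top (b := c * ∑' n, s n * ‖S (w n)‖ₑ)
      (ENNReal.mul_ne_top ENNReal.coe_ne_top h1) ?_, fun x y => ?_⟩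
    · rw [← ENNReal.tsum_mul_left]
      refine ENNReal.tsum_le_tsum fun n => ?_
      rw [enorm_smul, enorm_coe_nnreal]
      gcongr
      exact hc n
    · rw [ContinuousLinearMap.comp_apply, ← ContinuousLinearMap.adjoint_inner_left, hrep]
      refine tsum_congr fun n => ?_
      rw [ContinuousLinearMap.adjoint_inner_left, inner_smul_right]
      ring
  have hTS : IsNuclearRep (fun n => ContinuousLinearMap.adjoint S (v n))
      (fun n => ((s n : ℝ) : ℂ) • w n) (T ∘L S) := by
    refine ⟨ne_top_of_le_ne_top (b := d * ∑' n, s n * ‖ContinuousLinearMap.adjoint S (v n)‖ₑ)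
      (ENNReal.mul_ne_top ENNReal.coe_ne_top h2) ?_, fun x y => ?_⟩
    · rw [← ENNReal.tsum_mul_left]
      refine ENNReal.tsum_le_tsum fun n => ?_
      calc _ = ‖w n‖ₑ * (s n * ‖ContinuousLinearMap.adjoint S (v n)‖ₑ) := by
            rw [enorm_smul, enorm_coe_nnreal]; ring
        _ ≤ _ := by
            gcongr
            exact hd n
    · rw [ContinuousLinearMap.comp_apply, hrep]
      refine tsum_congr fun n => ?_
      rw [ContinuousLinearMap.adjoint_inner_left, inner_smul_right]
      ring
  refine ⟨hST.isSchatten, hTS.isSchatten, ?_⟩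
  -- Termwise, both traces are $s_n\langle v_n,Sw_n\rangle=s_n\langle S^*v_n,w_n\rangle$.
  rw [hST.trace_eq, hTS.trace_eq]
  refine tsum_congr fun n => ?_
  rw [inner_smul_right, inner_smul_right, ContinuousLinearMap.adjoint_inner_left]

/-- Products of trace class and bounded operators. -/
theorem traceCommutes_of_isSchatten_one (S : F →L[ℂ] E) {T : E →L[ℂ] F} (hT : IsSchatten 1 T) :
    TraceCommutes S T := by
  rw [isSchatten_iff_hasSchmidtRep le_rfl (by simp)] at hT
  obtain ⟨ι, s, v, w, hv, hw, hs, hrep⟩ := hT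
  simp only [ENNReal.toReal_one, ENNReal.rpow_one] at hs
  have key : ∀ {G G' : Type u} [NormedAddCommGroup G] [NormedAddCommGroup G'] [NormedSpace ℂ G]
      [NormedSpace ℂ G'] (R : G →L[ℂ] G') (z : ι → G) (c : ℝ≥0), (∀ n, ‖z n‖ₑ ≤ c) →
      ∑' n, s n * ‖R (z n)‖ₑ ≠ ∞ := by
    intro G G' _ _ _ _ R z c hc
    refine ne_top_of_le_ne_top (b := (∑' n, (s n : ℝ≥0∞)) * (‖R‖ₑ * c))
      (ENNReal.mul_ne_top hs (by finiteness)) ?_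
    rw [← ENNReal.tsum_mul_right]
    gcongr with n
    refine (R.le_opENorm _).trans ?_
    gcongr
    exact hc n
  obtain ⟨c, hc⟩ := hv.exists_enorm_le
  obtain ⟨d, hd⟩ := hw.exists_enorm_le
  exact traceCommutes_of_tsum_ne_top S hrep hv hw (key S w d hd) (key _ v c hc)

theorem traceCommutes_of_two_le {r t : ℝ} (hrt : r.HolderConjugate t) (hr : 2 ≤ r)
    {S : F →L[ℂ] E} {T : E →L[ℂ] F} (hS : HasSchmidtRep r S) (hT : HasSchmidtRep t T) :
    TraceCommutes S T := by
  obtain ⟨ι, s, v, w, hv, hw, hs, hrep⟩ := hT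
  have key : ∀ g : ι → ℝ≥0∞, ∑' n, g n ^ r ≠ ∞ → ∑' n, s n * g n ≠ ∞ := fun g hg =>
    ne_top_of_le_ne_top (ENNReal.mul_ne_top
      (ENNReal.rpow_ne_top_of_nonneg (by have := hrt.symm.pos; positivity) hs)
      (ENNReal.rpow_ne_top_of_nonneg (by have := hrt.pos; positivity) hg))
      (ennreal_inner_le_Lp_mul_Lq_tsum _ _ hrt.symm)
  exact traceCommutes_of_tsum_ne_top S hrep hv hw
    (key _ (hS.tsum_enorm_apply_rpow_ne_top hr hw))
    (key _ (hS.adjoint.tsum_enorm_apply_rpow_ne_top hr hv))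

/-- Hölder's inequality for Schatten classes and cyclicity of the trace. -/
theorem IsSchatten.traceCommutes {p q : ℝ≥0∞} (hpq : p⁻¹ + q⁻¹ = 1) {S : F →L[ℂ] E}
    {T : E →L[ℂ] F} (hS : IsSchatten p S) (hT : IsSchatten q T) : TraceCommutes S T := by
  by_cases hp : p = ∞
  · subst hp
    have : q = 1 := by simpa using hpq
    subst this
    exact traceCommutes_of_isSchatten_one S hT
  by_cases hq : q = ∞
  · subst hq
    have : p = 1 := by simpa using hpq
    subst this
    exact (traceCommutes_of_isSchatten_one T hS).symm
  have hp1 : 1 ≤ p := by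
    rw [← ENNReal.inv_le_one, ← hpq]; exact le_self_add
  have hq1 : 1 ≤ q := by
    rw [← ENNReal.inv_le_one, ← hpq]; exact le_add_self
  rw [isSchatten_iff_hasSchmidtRep hp1 hp] at hS
  rw [isSchatten_iff_hasSchmidtRep hq1 hq] at hT
  have h1 := one_le_toReal hp1 hp
  have h2 := one_le_toReal hq1 hq
  have hinv : p.toReal⁻¹ + q.toReal⁻¹ = 1 := by
    have := congrArg ENNReal.toReal hpq
    rwa [ENNReal.toReal_add (by simp; rintro rfl; simp at hp1) (by simp; rintro rfl; simp at hq1),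
      ENNReal.toReal_inv, ENNReal.toReal_inv, ENNReal.toReal_one] at this
  -- As $q<\infty$, $1/q>0$ excludes $p=1$.
  have hlt : 1 < p.toReal := by
    by_contra hcon
    have h3 : p.toReal = 1 := le_antisymm (not_lt.1 hcon) h1
    have h4 : 0 < q.toReal⁻¹ := by positivity
    rw [h3] at hinv
    linarith
  have hconj : p.toReal.HolderConjugate q.toReal := (Real.holderConjugate_iff).2 ⟨hlt, hinv⟩
  rcases le_total 2 p.toReal with h | h
  · exact traceCommutes_of_two_le hconj h hS hT
  · refine (traceCommutes_of_two_le hconj.symm ?_ hT hS).symm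
    have h3 : (2 : ℝ)⁻¹ ≤ p.toReal⁻¹ := by gcongr
    have h4 : q.toReal⁻¹ ≤ 2⁻¹ := by linarith
    exact (inv_le_inv₀ (by positivity) (by positivity)).1 h4

end Holder

/-! ### Block decomposition of the restricted algebra -/

section Blocks

variable {H : Type u} [NormedAddCommGroup H] [InnerProductSpace ℂ H]

/-- The block `pr_L ∘ A|_K : K → L` of `A`. -/
noncomputable def block (K L : Submodule ℂ H) [CompleteSpace L] (A : H →L[ℂ] H) : K →L[ℂ] L :=
  L.orthogonalProjectionOnto ∘L A ∘L K.subtypeL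

theorem diagBlock_eq_block (K : Submodule ℂ H) [CompleteSpace K] (A : H →L[ℂ] H) :
    diagBlock K A = block K K A := rfl

variable (P : Submodule ℂ H) [CompleteSpace P]

theorem dOp_apply_of_mem {x : H} (hx : x ∈ P) : dOp P x = Complex.I • x := by
  have h1 : P.starProjection x = x := Submodule.starProjection_eq_self_iff.2 hx
  have h2 : Pᗮ.starProjection x = 0 := by
    rw [Submodule.starProjection_apply_eq_zero_iff]
    exact P.le_orthogonal_orthogonal hx
  simp [dOp, h1, h2]

theorem dOp_apply_of_mem_orthogonal {x : H} (hx : x ∈ Pᗮ) : dOp P x = -Complex.I • x := by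
  have h1 : Pᗮ.starProjection x = x := Submodule.starProjection_eq_self_iff.2 hx
  have h2 : P.starProjection x = 0 := by
    rw [Submodule.starProjection_apply_eq_zero_iff]
    exact hx
  simp [dOp, h1, h2]

theorem dOp_apply (x : H) : dOp P x =
    Complex.I • (P.orthogonalProjectionOnto x : H) +
      -Complex.I • (Pᗮ.orthogonalProjectionOnto x : H) := by
  rw [neg_smul, ← sub_eq_add_neg, ← smul_sub]
  rfl

theorem orthogonalProjectionOnto_dOp (x : H) :
    P.orthogonalProjectionOnto (dOp P x) = Complex.I • P.orthogonalProjectionOnto x := by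
  have h : P.orthogonalProjectionOnto (Pᗮ.orthogonalProjectionOnto x : H) = 0 :=
    Submodule.orthogonalProjectionOnto_eq_zero_iff.2 (Pᗮ.orthogonalProjectionOnto x).2
  rw [dOp_apply, map_add, map_smul, map_smul, h,
    Submodule.orthogonalProjectionOnto_mem_subspace_eq_self, smul_zero, add_zero]

theorem orthogonalProjectionOnto_orthogonal_dOp (x : H) :
    Pᗮ.orthogonalProjectionOnto (dOp P x) = -Complex.I • Pᗮ.orthogonalProjectionOnto x := by
  have h : Pᗮ.orthogonalProjectionOnto (P.orthogonalProjectionOnto x : H) = 0 :=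
    Submodule.orthogonalProjectionOnto_eq_zero_iff.2
      (P.le_orthogonal_orthogonal (P.orthogonalProjectionOnto x).2)
  rw [dOp_apply, map_add, map_smul, map_smul, h,
    Submodule.orthogonalProjectionOnto_mem_subspace_eq_self, smul_zero, zero_add]

theorem block_commutator_left (A : H →L[ℂ] H) :
    block Pᗮ P (dOp P * A - A * dOp P) = (2 * Complex.I) • block Pᗮ P A := by
  ext x
  have h1 : block Pᗮ P (dOp P * A - A * dOp P) x =
      P.orthogonalProjectionOnto (dOp P (A x) - A (dOp P x)) := rfl
  have h2 : block Pᗮ P A x = P.orthogonalProjectionOnto (A x) := rfl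
  rw [h1, map_sub, orthogonalProjectionOnto_dOp, dOp_apply_of_mem_orthogonal P x.2, map_smul,
    map_smul, smul_apply, h2, ← sub_smul]
  congr 2
  ring

theorem block_commutator_self (A : H →L[ℂ] H) : block P P (dOp P * A - A * dOp P) = 0 := by
  ext x
  have h1 : block P P (dOp P * A - A * dOp P) x =
      P.orthogonalProjectionOnto (dOp P (A x) - A (dOp P x)) := rfl
  rw [h1, map_sub, orthogonalProjectionOnto_dOp, dOp_apply_of_mem P x.2, map_smul, map_smul,
    sub_self]
  rfl

variable [CompleteSpace H]

theorem block_mul (K L : Submodule ℂ H) [CompleteSpace L] (A B : H →L[ℂ] H) :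
    block K L (A * B) = block P L A ∘L block K P B + block Pᗮ L A ∘L block K Pᗮ B := by
  ext x
  have h : B x = P.starProjection (B x) + Pᗮ.starProjection (B x) :=
    (P.starProjection_add_starProjection_orthogonal (B x)).symm
  have h2 : block K L (A * B) x = L.orthogonalProjectionOnto (A (B x)) := rfl
  rw [h2, h, map_add, map_add]
  rfl

theorem block_commutator_right (A : H →L[ℂ] H) :
    block P Pᗮ (dOp P * A - A * dOp P) = (-2 * Complex.I) • block P Pᗮ A := by
  ext x
  have h1 : block P Pᗮ (dOp P * A - A * dOp P) x =
      Pᗮ.orthogonalProjectionOnto (dOp P (A x) - A (dOp P x)) := rfl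
  have h2 : block P Pᗮ A x = Pᗮ.orthogonalProjectionOnto (A x) := rfl
  rw [h1, map_sub, orthogonalProjectionOnto_orthogonal_dOp, dOp_apply_of_mem P x.2, map_smul,
    map_smul, smul_apply, h2, ← sub_smul]
  congr 2
  ring

theorem block_commutator_orthogonal (A : H →L[ℂ] H) :
    block Pᗮ Pᗮ (dOp P * A - A * dOp P) = 0 := by
  ext x
  have h1 : block Pᗮ Pᗮ (dOp P * A - A * dOp P) x =
      Pᗮ.orthogonalProjectionOnto (dOp P (A x) - A (dOp P x)) := rfl
  rw [h1, map_sub, orthogonalProjectionOnto_orthogonal_dOp, dOp_apply_of_mem_orthogonal P x.2,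
    map_smul, map_smul, sub_self]
  rfl

/-- An operator is recovered from its four blocks. -/
theorem eq_sum_blocks (X : H →L[ℂ] H) :
    X = (P.subtypeL ∘L block P P X ∘L P.orthogonalProjectionOnto +
        P.subtypeL ∘L block Pᗮ P X ∘L Pᗮ.orthogonalProjectionOnto) +
      (Pᗮ.subtypeL ∘L block P Pᗮ X ∘L P.orthogonalProjectionOnto +
        Pᗮ.subtypeL ∘L block Pᗮ Pᗮ X ∘L Pᗮ.orthogonalProjectionOnto) := by
  ext x
  have h1 : X x = P.starProjection (X x) + Pᗮ.starProjection (X x) :=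
    (P.starProjection_add_starProjection_orthogonal (X x)).symm
  have h2 : X x = X (P.starProjection x) + X (Pᗮ.starProjection x) := by
    rw [← map_add, P.starProjection_add_starProjection_orthogonal]
  conv_lhs => rw [h1, h2, map_add, map_add]
  rfl

variable {p q : ℝ≥0∞}

theorem mem_Lres_iff (hp : 1 ≤ p) {A : H →L[ℂ] H} :
    A ∈ Lres P p ↔ IsSchatten p (block P Pᗮ A) ∧ IsSchatten p (block Pᗮ P A) := by
  have e1 : ∀ X : P →L[ℂ] Pᗮ, X = ((-2 * Complex.I)⁻¹ : ℂ) • ((-2 * Complex.I) • X) := fun X => by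
    rw [smul_smul, inv_mul_cancel₀ (by simp), one_smul]
  have e2 : ∀ X : Pᗮ →L[ℂ] P, X = ((2 * Complex.I)⁻¹ : ℂ) • ((2 * Complex.I) • X) := fun X => by
    rw [smul_smul, inv_mul_cancel₀ (by simp), one_smul]
  constructor
  · intro h
    have h' : IsSchatten p (dOp P * A - A * dOp P) := h
    constructor
    · rw [e1 (block P Pᗮ A), ← block_commutator_right]
      exact (h'.comp hp _ _).smul hp _
    · rw [e2 (block Pᗮ P A), ← block_commutator_left]
      exact (h'.comp hp _ _).smul hp _
  · rintro ⟨h1, h2⟩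
    change IsSchatten p (dOp P * A - A * dOp P)
    rw [eq_sum_blocks P (dOp P * A - A * dOp P), block_commutator_self,
      block_commutator_orthogonal, block_commutator_left, block_commutator_right]
    simp only [ContinuousLinearMap.zero_comp, ContinuousLinearMap.comp_zero, zero_add, add_zero]
    exact IsSchatten.add hp ((h2.smul hp _).comp hp _ _) ((h1.smul hp _).comp hp _ _)

theorem mem_L1_iff (hq : 1 ≤ q) {ρ : H →L[ℂ] H} :
    ρ ∈ L1 P q ↔ (IsSchatten q (block P Pᗮ ρ) ∧ IsSchatten q (block Pᗮ P ρ)) ∧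
      IsSchatten 1 (block P P ρ) ∧ IsSchatten 1 (block Pᗮ Pᗮ ρ) :=
  -- The commutator condition in `L1 P q` is by definition membership in `Lres P q`.
  and_congr_left fun _ => mem_Lres_iff P hq

theorem one_le_left (hpq : p⁻¹ + q⁻¹ = 1) : 1 ≤ p := by
  rw [← ENNReal.inv_le_one, ← hpq]
  exact le_self_add

theorem one_le_right (hpq : p⁻¹ + q⁻¹ = 1) : 1 ≤ q :=
  one_le_left (add_comm p⁻¹ q⁻¹ ▸ hpq)

/-- Hölder is needed only in the diagonal blocks, for products of two off-diagonal blocks; every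
other term has a factor from $\alpha$ already in the required class, using $L_1\subset L_q$. -/
theorem mul_mem_L1 (hpq : p⁻¹ + q⁻¹ = 1) {A α : H →L[ℂ] H} (hA : A ∈ Lres P p)
    (hα : α ∈ L1 P q) : A * α ∈ L1 P q := by
  have hp := one_le_left hpq
  have hq := one_le_right hpq
  rw [mem_Lres_iff P hp] at hA
  rw [mem_L1_iff P hq] at hα ⊢
  obtain ⟨hA1, hA2⟩ := hA
  obtain ⟨⟨h1, h2⟩, h3, h4⟩ := hα
  refine ⟨⟨?_, ?_⟩, ?_, ?_⟩ <;> rw [block_mul P]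
  · exact ((h3.of_one hq).clm_comp hq _).add hq (h1.clm_comp hq _)
  · exact (h2.clm_comp hq _).add hq ((h4.of_one hq).clm_comp hq _)
  · exact (h3.clm_comp le_rfl _).add le_rfl (hA2.traceCommutes hpq h1).left
  · exact (hA1.traceCommutes hpq h2).left.add le_rfl (h4.clm_comp le_rfl _)

theorem L1_mul_mem (hpq : p⁻¹ + q⁻¹ = 1) {A α : H →L[ℂ] H} (hA : A ∈ Lres P p)
    (hα : α ∈ L1 P q) : α * A ∈ L1 P q := by
  have hp := one_le_left hpq
  have hq := one_le_right hpq
  rw [mem_Lres_iff P hp] at hA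
  rw [mem_L1_iff P hq] at hα ⊢
  obtain ⟨hA1, hA2⟩ := hA
  obtain ⟨⟨h1, h2⟩, h3, h4⟩ := hα
  refine ⟨⟨?_, ?_⟩, ?_, ?_⟩ <;> rw [block_mul P]
  · exact (h1.comp_clm hq _).add hq ((h4.of_one hq).comp_clm hq _)
  · exact ((h3.of_one hq).comp_clm hq _).add hq (h2.comp_clm hq _)
  · exact (h3.comp_clm le_rfl _).add le_rfl (hA1.traceCommutes hpq h2).right
  · exact (hA2.traceCommutes hpq h1).right.add le_rfl (h4.comp_clm le_rfl _)

/-- Cyclicity on blocks sends the mixed term of one diagonal block of $A\alpha$ to the mixed term of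
the other diagonal block of $\alpha A$, so only the sum of both traces is invariant. -/
theorem trRes_mul_comm (hpq : p⁻¹ + q⁻¹ = 1) {A α : H →L[ℂ] H} (hA : A ∈ Lres P p)
    (hα : α ∈ L1 P q) : trRes P (A * α) = trRes P (α * A) := by
  have hp := one_le_left hpq
  have hq := one_le_right hpq
  rw [mem_Lres_iff P hp] at hA
  rw [mem_L1_iff P hq] at hα
  obtain ⟨hA1, hA2⟩ := hA
  obtain ⟨⟨h1, h2⟩, h3, h4⟩ := hα
  have c1 := hA2.traceCommutes hpq h1
  have c2 := hA1.traceCommutes hpq h2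
  have c3 := traceCommutes_of_isSchatten_one (block P P A) h3
  have c4 := traceCommutes_of_isSchatten_one (block Pᗮ Pᗮ A) h4
  unfold trRes
  simp only [diagBlock_eq_block]
  rw [block_mul P P P, block_mul P Pᗮ Pᗮ, block_mul P P P, block_mul P Pᗮ Pᗮ,
    trace_add c3.left c1.left, trace_add c2.left c4.left, trace_add c3.right c2.right,
    trace_add c1.right c4.right, c1.trace_eq, c2.trace_eq, c3.trace_eq, c4.trace_eq]
  ring

theorem mul_mem_Lres (hp : 1 ≤ p) {A B : H →L[ℂ] H} (hA : A ∈ Lres P p) (hB : B ∈ Lres P p) :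
    A * B ∈ Lres P p := by
  have hA' : IsSchatten p (dOp P * A - A * dOp P) := hA
  have hB' : IsSchatten p (dOp P * B - B * dOp P) := hB
  -- The Leibniz rule for the derivation $[d,\cdot]$.
  have h : dOp P * (A * B) - A * B * dOp P =
      (dOp P * A - A * dOp P) * B + A * (dOp P * B - B * dOp P) := by
    noncomm_ring
  change IsSchatten p (dOp P * (A * B) - A * B * dOp P)
  rw [h]
  exact (hA'.comp_clm hp B).add hp (hB'.clm_comp hp A)

theorem inv_mem_Lres (hp : 1 ≤ p) {g h : H →L[ℂ] H} (hgh : g * h = 1) (hhg : h * g = 1)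
    (hg : g ∈ Lres P p) : h ∈ Lres P p := by
  have hg' : IsSchatten p (dOp P * g - g * dOp P) := hg
  have e : dOp P * h - h * dOp P = (-1 : ℂ) • (h * ((dOp P * g - g * dOp P) * h)) := by
    rw [neg_one_smul, sub_mul, mul_assoc (dOp P), hgh, mul_one, mul_sub, mul_assoc g,
      ← mul_assoc h g, hhg, one_mul, neg_sub]
  change IsSchatten p (dOp P * h - h * dOp P)
  rw [e]
  exact (hg'.comp hp h h).smul hp _

end Blocks

end RestrictedTrace

theorem mainTheorem10 {H : Type*} [NormedAddCommGroup H] [InnerProductSpace ℂ H] [CompleteSpace H]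
    [TopologicalSpace.SeparableSpace H] (Hp : Submodule ℂ H) [CompleteSpace Hp]
    (hp_inf : ¬ FiniteDimensional ℂ Hp) (hm_inf : ¬ FiniteDimensional ℂ Hpᗮ)
    (p q : ℝ≥0∞) (hpq : p⁻¹ + q⁻¹ = 1) :
    (∀ A ∈ RestrictedTrace.Lres Hp p, ∀ α ∈ RestrictedTrace.L1 Hp q,
      A * α ∈ RestrictedTrace.L1 Hp q ∧ α * A ∈ RestrictedTrace.L1 Hp q ∧
      RestrictedTrace.trRes Hp (A * α) = RestrictedTrace.trRes Hp (α * A)) ∧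
    (∀ g : (H →L[ℂ] H)ˣ, (g : H →L[ℂ] H) ∈ RestrictedTrace.Lres Hp p →
      ((g⁻¹ : (H →L[ℂ] H)ˣ) : H →L[ℂ] H) ∈ RestrictedTrace.Lres Hp p ∧
      (∀ A ∈ RestrictedTrace.Lres Hp p, ∀ α ∈ RestrictedTrace.L1 Hp q,
        (g * A * (g⁻¹ : (H →L[ℂ] H)ˣ) : H →L[ℂ] H) ∈ RestrictedTrace.Lres Hp p ∧
        ((g⁻¹ : (H →L[ℂ] H)ˣ) * α * g : H →L[ℂ] H) ∈ RestrictedTrace.L1 Hp q ∧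
        α * g * A * (g⁻¹ : (H →L[ℂ] H)ˣ) ∈ RestrictedTrace.L1 Hp q ∧
        (g⁻¹ : (H →L[ℂ] H)ˣ) * α * g * A ∈ RestrictedTrace.L1 Hp q ∧
        RestrictedTrace.pairing Hp α (g * A * (g⁻¹ : (H →L[ℂ] H)ˣ)) =
          RestrictedTrace.trRes Hp (α * g * A * (g⁻¹ : (H →L[ℂ] H)ˣ)) ∧
        RestrictedTrace.trRes Hp (α * g * A * (g⁻¹ : (H →L[ℂ] H)ˣ)) =
          RestrictedTrace.trRes Hp ((g⁻¹ : (H →L[ℂ] H)ˣ) * α * g * A) ∧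
        RestrictedTrace.trRes Hp ((g⁻¹ : (H →L[ℂ] H)ˣ) * α * g * A) =
          RestrictedTrace.pairing Hp ((g⁻¹ : (H →L[ℂ] H)ˣ) * α * g) A) ∧
      (∀ α ∈ RestrictedTrace.L1 Hp q,
        g * α * (g⁻¹ : (H →L[ℂ] H)ˣ) ∈ RestrictedTrace.L1 Hp q ∧
        RestrictedTrace.trRes Hp (g * α * (g⁻¹ : (H →L[ℂ] H)ˣ)) =
          RestrictedTrace.trRes Hp α)) := by
  have hp := RestrictedTrace.one_le_left hpq
  refine ⟨fun A hA α hα => ⟨RestrictedTrace.mul_mem_L1 Hp hpq hA hα,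
    RestrictedTrace.L1_mul_mem Hp hpq hA hα, RestrictedTrace.trRes_mul_comm Hp hpq hA hα⟩,
    fun g hg => ?_⟩
  have hi : ((g⁻¹ : (H →L[ℂ] H)ˣ) : H →L[ℂ] H) ∈ RestrictedTrace.Lres Hp p :=
    RestrictedTrace.inv_mem_Lres Hp hp g.mul_inv g.inv_mul hg
  refine ⟨hi, fun A hA α hα => ?_, fun α hα => ?_⟩
  · have hαg := RestrictedTrace.L1_mul_mem Hp hpq hg hα
    have hαgA := RestrictedTrace.L1_mul_mem Hp hpq hA hαg
    -- Cyclicity with the factors $g^{-1}\in L_{\mathrm{res},p}$ and $\alpha gA\in L_{1,q}$.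
    have hcomm := RestrictedTrace.trRes_mul_comm Hp hpq hi hαgA
    have hassoc : (g⁻¹ : (H →L[ℂ] H)ˣ) * (α * g * A) = (g⁻¹ : (H →L[ℂ] H)ˣ) * α * g * A := by
      simp only [mul_assoc]
    rw [hassoc] at hcomm
    refine ⟨RestrictedTrace.mul_mem_Lres Hp hp (RestrictedTrace.mul_mem_Lres Hp hp hg hA) hi,
      RestrictedTrace.L1_mul_mem Hp hpq hg (RestrictedTrace.mul_mem_L1 Hp hpq hi hα),
      RestrictedTrace.L1_mul_mem Hp hpq hi hαgA,
      hassoc ▸ RestrictedTrace.mul_mem_L1 Hp hpq hi hαgA, ?_, hcomm.symm, rfl⟩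
    simp only [RestrictedTrace.pairing, mul_assoc]
  · have hgα := RestrictedTrace.mul_mem_L1 Hp hpq hg hα
    refine ⟨RestrictedTrace.L1_mul_mem Hp hpq hi hgα, ?_⟩
    rw [← RestrictedTrace.trRes_mul_comm Hp hpq hi hgα, g.inv_mul_cancel_left]
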